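/- Let $n\ge 1$ and let $P_0 = v\cdot\nabla_x-\Delta_v+\frac14|v|^2-\frac n2$ be the free Kramers--Fokker--Planck operator in $L^2(\mathbb R^n_x\times\mathbb R^n_v)$ (complex-valued functions, Lebesgue measure), with its maximal domain $D(P_0)=\{u\in L^2(\mathbb R^{2n}) : P_0u\in L^2(\mathbb R^{2n})\}$, where $P_0u$ is taken in the sense of distributions. Then the spectrum of $P_0$, i.e. the set of $z\in\mathbb C$ for which $P_0-z: D(P_0)\to L^2(\mathbb R^{2n})$ has no bounded everywhere defined two-sided inverse, is $$\sigma(P_0)=[0,+\infty[\,.$$ -/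

import Mathlib

open MeasureTheory
open scoped SchwartzMap LineDeriv

noncomputable section

namespace KFP

/-- The phase space `ℝⁿ × ℝⁿ` of positions and velocities `(x, v)`. -/
abbrev Phase (n : ℕ) : Type :=
  EuclideanSpace ℝ (Fin n) × EuclideanSpace ℝ (Fin n)

instance instIsAddHaarMeasureVolume (n : ℕ) :
    (volume : Measure (Phase n)).IsAddHaarMeasure :=
  inferInstanceAs (Measure.IsAddHaarMeasure
    ((volume : Measure (EuclideanSpace ℝ (Fin n))).prod
      (volume : Measure (EuclideanSpace ℝ (Fin n)))))

/-- The complex Hilbert space `L²(ℝⁿ × ℝⁿ)` with respect to Lebesgue measure `dx dv`. -/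
abbrev L2 (n : ℕ) : Type :=
  Lp ℂ 2 (volume : Measure (Phase n))

/-- The `j`-th unit vector in the position directions. -/
def ex {n : ℕ} (j : Fin n) : Phase n := (EuclideanSpace.single j 1, 0)

/-- The `j`-th unit vector in the velocity directions. -/
def ev {n : ℕ} (j : Fin n) : Phase n := (0, EuclideanSpace.single j 1)

/-- The coordinate function `(x, v) ↦ v_j`. -/
def vCoord {n : ℕ} (j : Fin n) : Phase n → ℂ := fun p => ((p.2 j : ℝ) : ℂ)

/-- The function `(x, v) ↦ |v|²`. -/
def vNormSq {n : ℕ} : Phase n → ℂ := fun p => ((‖p.2‖ ^ 2 : ℝ) : ℂ)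

/-- `v_j` has temperate growth, so that `smulLeftCLM` really multiplies by `v_j`. -/
theorem hasTemperateGrowth_vCoord {n : ℕ} (j : Fin n) :
    (vCoord (n := n) j).HasTemperateGrowth :=
  (Complex.ofRealCLM ∘L (EuclideanSpace.proj j : EuclideanSpace ℝ (Fin n) →L[ℝ] ℝ) ∘L
    ContinuousLinearMap.snd ℝ (EuclideanSpace ℝ (Fin n))
      (EuclideanSpace ℝ (Fin n))).hasTemperateGrowth

/-- `|v|²` has temperate growth, so that `smulLeftCLM` really multiplies by `|v|²`. -/
theorem hasTemperateGrowth_vNormSq {n : ℕ} : (vNormSq (n := n)).HasTemperateGrowth :=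
  Function.Complex.hasTemperateGrowth_ofReal.comp
    ((Function.hasTemperateGrowth_norm_sq (EuclideanSpace ℝ (Fin n))).comp
      (ContinuousLinearMap.snd ℝ (EuclideanSpace ℝ (Fin n))
        (EuclideanSpace ℝ (Fin n))).hasTemperateGrowth)

/-- The formal free Kramers-Fokker-Planck operator `v·∇ₓ - Δ_v + |v|²/4 - n/2`, acting on
tempered distributions on `ℝⁿ × ℝⁿ`. -/
def freeKFPDistrib (n : ℕ) : 𝓢'(Phase n, ℂ) →L[ℂ] 𝓢'(Phase n, ℂ) :=
  (∑ j : Fin n, TemperedDistribution.smulLeftCLM ℂ (vCoord j) ∘L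
      LineDeriv.lineDerivOpCLM ℂ 𝓢'(Phase n, ℂ) (ex j))
    - (∑ j : Fin n, LineDeriv.lineDerivOpCLM ℂ 𝓢'(Phase n, ℂ) (ev j) ∘L
        LineDeriv.lineDerivOpCLM ℂ 𝓢'(Phase n, ℂ) (ev j))
    + (1 / 4 : ℂ) • TemperedDistribution.smulLeftCLM ℂ vNormSq
    - ((n : ℂ) / 2) • ContinuousLinearMap.id ℂ 𝓢'(Phase n, ℂ)

/-- The canonical embedding of `L²` into the tempered distributions. -/
def L2.toDistrib (n : ℕ) : L2 n →ₗ[ℂ] 𝓢'(Phase n, ℂ) :=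
  (Lp.toTemperedDistributionCLM ℂ (volume : Measure (Phase n)) 2).toLinearMap

/-- The graph of the maximal realization in `L²`: all pairs `(u, f)` in `L² × L²` such that
`f = v·∇ₓu - Δ_v u + |v|²u/4 - nu/2` in the sense of (tempered) distributions. -/
def freeKFPGraph (n : ℕ) : Submodule ℂ (L2 n × L2 n) where
  carrier := {p | freeKFPDistrib n (L2.toDistrib n p.1) = L2.toDistrib n p.2}
  add_mem' {p q} hp hq := by
    simp only [Set.mem_ofPred_eq] at hp hq ⊢
    simp only [Prod.fst_add, Prod.snd_add, map_add, hp, hq]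
  zero_mem' := by simp
  smul_mem' c p hp := by
    simp only [Set.mem_ofPred_eq] at hp ⊢
    simp only [Prod.smul_fst, Prod.smul_snd, map_smul, hp]

/-- The free Kramers-Fokker-Planck operator `P₀` in `L²(ℝⁿ × ℝⁿ)` with maximal domain
`{u ∈ L² | P₀ u ∈ L²}`, as an unbounded linear operator. -/
def freeKFP (n : ℕ) : L2 n →ₗ.[ℂ] L2 n := (freeKFPGraph n).toLinearPMap

theorem freeKFPGraph_snd_eq_zero (n : ℕ) (p : L2 n × L2 n) (hp : p ∈ freeKFPGraph n)
    (h0 : p.1 = 0) : p.2 = 0 := by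
  have h : freeKFPDistrib n (L2.toDistrib n p.1) = L2.toDistrib n p.2 := hp
  rw [h0, map_zero, map_zero] at h
  have hk : p.2 ∈ (Lp.toTemperedDistributionCLM ℂ (volume : Measure (Phase n)) 2).ker := h.symm
  rw [Lp.ker_toTemperedDistributionCLM_eq_bot] at hk
  exact hk

theorem mem_freeKFP_domain_iff (n : ℕ) (u : L2 n) :
    u ∈ (freeKFP n).domain ↔
      ∃ f : L2 n, freeKFPDistrib n (L2.toDistrib n u) = L2.toDistrib n f := by
  change u ∈ (freeKFPGraph n).map (LinearMap.fst ℂ (L2 n) (L2 n)) ↔ _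
  simp only [Submodule.mem_map, LinearMap.fst_apply, Prod.exists, exists_and_right,
    exists_eq_right]
  rfl

theorem toDistrib_freeKFP_apply (n : ℕ) (u : (freeKFP n).domain) :
    L2.toDistrib n (freeKFP n u) = freeKFPDistrib n (L2.toDistrib n (u : L2 n)) :=
  ((freeKFPGraph n).mem_graph_toLinearPMap (freeKFPGraph_snd_eq_zero n) u).symm

/-- The resolvent set of an unbounded operator `A`: the `z ∈ ℂ` for which `A - z`, from the domain
of `A` to the whole space, has a bounded everywhere defined two-sided inverse `R = (A - z)⁻¹`. -/
def resolventSetOf {H : Type*} [NormedAddCommGroup H] [NormedSpace ℂ H] (A : H →ₗ.[ℂ] H) :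
    Set ℂ :=
  {z | ∃ R : H →L[ℂ] H,
    (∀ f : H, ∃ h : R f ∈ A.domain, A ⟨R f, h⟩ - z • R f = f) ∧
    (∀ u : A.domain, R (A u - z • (u : H)) = u)}

/-- The spectrum of an unbounded operator: the complement of its resolvent set. -/
def spectrumOf {H : Type*} [NormedAddCommGroup H] [NormedSpace ℂ H] (A : H →ₗ.[ℂ] H) :
    Set ℂ :=
  (resolventSetOf A)ᶜ

end KFP

end

/-! Write `P₀ = v·∇ₓ + N` with `N = ∑ a_j* a_j` and `a_j = ∂_{v_j} + v_j/2`. On products `φ(x - v)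
h(v)` the transport term combines with the cross terms of `-Δ_v` and only annihilation operators
survive (`kfpSchwartz_shearTensorL`). After a Fourier transform in the sheared position, `P₀` acts
at frequency `ξ` as `N + |ξ|² + 2i ξ·a`. This is triangular for the grading by Hermite levels, with
diagonal entries `k + |ξ|²`, which fill `[0, ∞)`.

Off the half-line a bound uniform in `ξ` is needed, and the fibres are not normal. For bounded `ξ`
the coupling between neighbouring levels, of size `|ξ|√k`, is dominated by the diagonal at high
levels (`lower_bound_of_norm_le`). For large `ξ` the fibre is rewritten as a nonnegative plus a
skew-adjoint operator, and a commutator argument rules out approximate eigenvectors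
(`frequency_bound`). Plancherel turns this into a resolvent estimate on the core
(`norm_le_of_mem_coreSpace`). The triangular system is solved level by level through Helmholtz
equations (`exists_preimage_of_mem_coreSpace`), the core is dense because Hermite functions are
complete (`dense_coreSpace`), and the graph is closed, so `P₀ - z` is onto. Injectivity on the
maximal domain comes from solving the transposed equation, in which the transport term changes sign
(`eigenvector_eq_zero`).

On the half-line, take `h` Gaussian: it is annihilated by all `a_j`, so `P₀` acts as `-Δ` on `φ`,
whose approximate eigenfunctions exclude a bounded inverse (`notMem_resolventSetOf`). -/

noncomputable section

namespace KFP

open scoped InnerProductSpace ContDiff FourierTransform ENNReal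

/-! ### Ladder operators on a pre-Hilbert space -/

section Ladder

variable {S H : Type*} [AddCommGroup S] [Module ℂ S] [NormedAddCommGroup H]
  [InnerProductSpace ℂ H] {n : ℕ}

/-- Annihilation operators `a j` and creation operators `a' j` satisfying the canonical commutation
relations and formally adjoint to each other for the inner product pulled back along `ι`. -/
structure IsLadder (ι : S →ₗ[ℂ] H) (a a' : Fin n → S →ₗ[ℂ] S) : Prop where
  adj : ∀ j f g, ⟪ι (a j f), ι g⟫_ℂ = ⟪ι f, ι (a' j g)⟫_ℂ
  comm : ∀ j k f, a j (a k f) = a k (a j f)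
  comm' : ∀ j k f, a' j (a' k f) = a' k (a' j f)
  ccr : ∀ j k f, a j (a' k f) = a' k (a j f) + if j = k then f else 0

theorem inner_self_eq_ofReal (x : H) : ⟪x, x⟫_ℂ = ((‖x‖ ^ 2 : ℝ) : ℂ) := by
  rw [inner_self_eq_norm_sq_to_K]
  norm_cast

/-- The number operator `∑ a'_j a_j`. -/
def numberOp (a a' : Fin n → S →ₗ[ℂ] S) : S →ₗ[ℂ] S := ∑ j, a' j ∘ₗ a j

/-- The contraction `∑ ξ_j a_j`. -/
def contractOp (a : Fin n → S →ₗ[ℂ] S) (ξ : EuclideanSpace ℝ (Fin n)) : S →ₗ[ℂ] S :=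
  ∑ j, ((ξ j : ℝ) : ℂ) • a j

/-- The fibre operator `N + |ξ|² + 2i ξ·a`. -/
def fibreOp (a a' : Fin n → S →ₗ[ℂ] S) (ξ : EuclideanSpace ℝ (Fin n)) : S →ₗ[ℂ] S :=
  numberOp a a' + ((‖ξ‖ ^ 2 : ℝ) : ℂ) • LinearMap.id + (2 * Complex.I) • contractOp a ξ

theorem numberOp_apply (a a' : Fin n → S →ₗ[ℂ] S) (f : S) :
    numberOp a a' f = ∑ j, a' j (a j f) := by
  simp [numberOp, LinearMap.sum_apply]

theorem contractOp_apply (a : Fin n → S →ₗ[ℂ] S) (ξ : EuclideanSpace ℝ (Fin n)) (f : S) :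
    contractOp a ξ f = ∑ j, ((ξ j : ℝ) : ℂ) • a j f := by
  simp [contractOp, LinearMap.sum_apply]

theorem fibreOp_apply (a a' : Fin n → S →ₗ[ℂ] S) (ξ : EuclideanSpace ℝ (Fin n)) (f : S) :
    fibreOp a a' ξ f = numberOp a a' f + ((‖ξ‖ ^ 2 : ℝ) : ℂ) • f
      + (2 * Complex.I) • contractOp a ξ f := by
  simp [fibreOp]

namespace IsLadder

variable {ι : S →ₗ[ℂ] H} {a a' : Fin n → S →ₗ[ℂ] S}

theorem adj' (h : IsLadder ι a a') (j : Fin n) (f g : S) :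
    ⟪ι (a' j f), ι g⟫_ℂ = ⟪ι f, ι (a j g)⟫_ℂ := by
  rw [← inner_conj_symm, ← h.adj, inner_conj_symm]

theorem inner_numberOp (h : IsLadder ι a a') (f g : S) :
    ⟪ι f, ι (numberOp a a' g)⟫_ℂ = ∑ j, ⟪ι (a j f), ι (a j g)⟫_ℂ := by
  simp [numberOp_apply, map_sum, h.adj]

theorem numberOp_symm (h : IsLadder ι a a') (f g : S) :
    ⟪ι (numberOp a a' f), ι g⟫_ℂ = ⟪ι f, ι (numberOp a a' g)⟫_ℂ := by
  rw [h.inner_numberOp]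
  simp [numberOp_apply, map_sum, h.adj']

theorem inner_numberOp_self (h : IsLadder ι a a') (f : S) :
    ⟪ι f, ι (numberOp a a' f)⟫_ℂ = ((∑ j, ‖ι (a j f)‖ ^ 2 : ℝ) : ℂ) := by
  rw [h.inner_numberOp]
  push_cast
  exact Finset.sum_congr rfl fun j _ => inner_self_eq_norm_sq_to_K _

theorem annihilate_numberOp (h : IsLadder ι a a') (k : Fin n) (f : S) :
    a k (numberOp a a' f) = numberOp a a' (a k f) + a k f := by
  simp [numberOp_apply, map_sum, h.ccr, h.comm k, Finset.sum_add_distrib]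

theorem numberOp_create (h : IsLadder ι a a') (k : Fin n) (f : S) :
    numberOp a a' (a' k f) = a' k (numberOp a a' f) + a' k f := by
  simp only [numberOp_apply, map_sum, h.ccr, map_add, Finset.sum_add_distrib]
  congr 1
  · exact Finset.sum_congr rfl fun j _ => h.comm' _ _ _
  · rw [Finset.sum_eq_single k] <;> simp +contextual

theorem contract_adj (h : IsLadder ι a a') (ξ : EuclideanSpace ℝ (Fin n)) (f g : S) :
    ⟪ι (contractOp a ξ f), ι g⟫_ℂ = ⟪ι f, ι (contractOp a' ξ g)⟫_ℂ := by
  simp [contractOp_apply, h.adj]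

theorem contract_numberOp (h : IsLadder ι a a') (ξ : EuclideanSpace ℝ (Fin n)) (f : S) :
    contractOp a ξ (numberOp a a' f) = numberOp a a' (contractOp a ξ f) + contractOp a ξ f := by
  simp [contractOp_apply, h.annihilate_numberOp, map_sum, Finset.sum_add_distrib]

theorem contract_contract (h : IsLadder ι a a') (ξ : EuclideanSpace ℝ (Fin n)) (f : S) :
    contractOp a ξ (contractOp a' ξ f)
      = contractOp a' ξ (contractOp a ξ f) + ((‖ξ‖ ^ 2 : ℝ) : ℂ) • f := by
  have hs : ((‖ξ‖ ^ 2 : ℝ) : ℂ) • f = ∑ j, ((ξ j : ℝ) : ℂ) • ((ξ j : ℝ) : ℂ) • f := by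
    rw [EuclideanSpace.norm_sq_eq, Complex.ofReal_sum, Finset.sum_smul]
    exact Finset.sum_congr rfl fun j _ => by rw [smul_smul]; simp [sq]
  rw [hs]
  simp only [contractOp_apply, map_sum, map_smul, h.ccr, smul_add, Finset.sum_add_distrib,
    Finset.smul_sum]
  congr 1
  · rw [Finset.sum_comm]
    exact Finset.sum_congr rfl fun j _ => Finset.sum_congr rfl fun k _ => smul_comm _ _ _
  · exact Finset.sum_congr rfl fun j _ => by
      rw [Finset.sum_eq_single j] <;> simp +contextual [eq_comm]

/-- Cauchy–Schwarz over the index `j`; no commutation relation enters. -/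
theorem norm_contract_le (ι : S →ₗ[ℂ] H) (a : Fin n → S →ₗ[ℂ] S) (ξ : EuclideanSpace ℝ (Fin n))
    (f : S) : ‖ι (contractOp a ξ f)‖ ≤ ‖ξ‖ * √(∑ j, ‖ι (a j f)‖ ^ 2) := by
  calc ‖ι (contractOp a ξ f)‖ ≤ ∑ j, ‖ξ j‖ * ‖ι (a j f)‖ := by
        simp only [contractOp_apply, map_sum, map_smul]
        refine (norm_sum_le _ _).trans_eq (Finset.sum_congr rfl fun j _ => ?_)
        rw [norm_smul, Complex.norm_real]
    _ ≤ √(∑ j, ‖ξ j‖ ^ 2) * √(∑ j, ‖ι (a j f)‖ ^ 2) := Real.sum_mul_le_sqrt_mul_sqrt _ _ _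
    _ = _ := by rw [EuclideanSpace.norm_eq]

/-- The two squared norms differ by the commutator `[ξ·a, ξ·a'] = |ξ|²`. -/
theorem norm_contract_create_sq (h : IsLadder ι a a') (ξ : EuclideanSpace ℝ (Fin n)) (f : S) :
    ‖ι (contractOp a' ξ f)‖ ^ 2 = ‖ι (contractOp a ξ f)‖ ^ 2 + ‖ξ‖ ^ 2 * ‖ι f‖ ^ 2 := by
  have h1 : ⟪ι (contractOp a' ξ f), ι (contractOp a' ξ f)⟫_ℂ
      = ⟪ι (contractOp a ξ f), ι (contractOp a ξ f)⟫_ℂ + ((‖ξ‖ ^ 2 : ℝ) : ℂ) * ⟪ι f, ι f⟫_ℂ := by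
    rw [← h.contract_adj, h.contract_contract, map_add, inner_add_left, map_smul,
      inner_smul_left, Complex.conj_ofReal]
    congr 1
    rw [← inner_conj_symm, ← h.contract_adj, inner_conj_symm]
  simp only [inner_self_eq_ofReal] at h1
  exact_mod_cast h1

/-- Scalars do not affect commutators, and `iξ_j` is purely imaginary, so adjointness survives. For
the oscillator this is conjugation by the phase `e^{iξ·v}`, which undoes the shear. -/
theorem shift (h : IsLadder ι a a') (ξ : EuclideanSpace ℝ (Fin n)) :
    IsLadder ι (fun j => a j - (Complex.I * (ξ j : ℝ)) • LinearMap.id)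
      (fun j => a' j + (Complex.I * (ξ j : ℝ)) • LinearMap.id) where
  adj j f g := by
    simp [h.adj, mul_comm]
  comm j k f := by
    simp only [LinearMap.sub_apply, LinearMap.smul_apply, LinearMap.id_apply, map_sub, map_smul,
      h.comm j k, smul_sub, smul_smul]
    rw [mul_comm (Complex.I * (ξ j : ℝ) : ℂ)]
    abel
  comm' j k f := by
    simp only [LinearMap.add_apply, LinearMap.smul_apply, LinearMap.id_apply, map_add, map_smul,
      h.comm' j k, smul_add, smul_smul]
    rw [mul_comm (Complex.I * (ξ j : ℝ) : ℂ)]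
    abel
  ccr j k f := by
    simp only [LinearMap.sub_apply, LinearMap.add_apply, LinearMap.smul_apply, LinearMap.id_apply,
      map_sub, map_add, map_smul, h.ccr j k, smul_add, smul_sub, smul_smul]
    rw [mul_comm (Complex.I * (ξ j : ℝ) : ℂ)]
    abel

/-- With `b_j = a_j - iξ_j` one has `b'_j b_j = a'_j a_j + iξ_j a_j - iξ_j a'_j + ξ_j²`, and adding
`iξ_j (b_j + b'_j)` cancels the creation term. The result is a nonnegative symmetric operator plus a
skew one. -/
theorem fibreOp_eq_shift (a a' : Fin n → S →ₗ[ℂ] S) (ξ : EuclideanSpace ℝ (Fin n)) (f : S) :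
    fibreOp a a' ξ f =
      numberOp (fun j => a j - (Complex.I * (ξ j : ℝ)) • LinearMap.id)
        (fun j => a' j + (Complex.I * (ξ j : ℝ)) • LinearMap.id) f
      + Complex.I • (contractOp (fun j => a j - (Complex.I * (ξ j : ℝ)) • LinearMap.id) ξ f
        + contractOp (fun j => a' j + (Complex.I * (ξ j : ℝ)) • LinearMap.id) ξ f) := by
  rw [fibreOp_apply, EuclideanSpace.norm_sq_eq, Complex.ofReal_sum, Finset.sum_smul]
  simp only [numberOp_apply, contractOp_apply, Finset.smul_sum, smul_add,
    ← Finset.sum_add_distrib]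
  refine Finset.sum_congr rfl fun j _ => ?_
  simp only [LinearMap.sub_apply, LinearMap.add_apply, LinearMap.smul_apply, LinearMap.id_apply,
    map_sub, map_smul, smul_sub, smul_add, smul_smul]
  have e : ((‖ξ j‖ ^ 2 : ℝ) : ℂ) = (ξ j : ℝ) * (ξ j : ℝ) := by simp [sq]
  have hI : Complex.I * ((ξ j : ℝ) : ℂ) * (Complex.I * ((ξ j : ℝ) : ℂ))
      = -(((ξ j : ℝ) : ℂ) * (ξ j : ℝ)) := by linear_combination ((ξ j : ℝ) : ℂ)^2 * Complex.I_sq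
  have hI' : Complex.I * (((ξ j : ℝ) : ℂ) * (Complex.I * ((ξ j : ℝ) : ℂ)))
      = -(((ξ j : ℝ) : ℂ) * (ξ j : ℝ)) := by linear_combination ((ξ j : ℝ) : ℂ)^2 * Complex.I_sq
  rw [e, hI, hI']
  module

end IsLadder

/-- Here `s = |ξ|`, `U = ‖f‖`, `m² = ∑ ‖b_j f‖²`, `μ = ‖N f‖` and `p = ‖P f‖`. The hypotheses give
`m ≲ U`, `μ² ≲ (1 + s) U²` and, after cancelling one `s`, `s U² ≲ U² + μ U`; hence `s ≲ 1 + √s`. -/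
theorem frequency_bound_of_inequalities {s U m μ p κ : ℝ} (hs : 0 ≤ s) (hU : 0 < U) (hm : 0 ≤ m)
    (hμ : 0 ≤ μ) (hp : 0 ≤ p) (hκ : 1 ≤ κ) (h1 : p ≤ κ * U) (h2 : m ^ 2 ≤ κ * U ^ 2)
    (h3 : μ ^ 2 ≤ μ * p + s * m * U)
    (h4 : s ^ 2 * U ^ 2 ≤ s * (m + U) * p + (2 * μ + p) * (s * m) + U * (s * m)) :
    s ≤ 8 * κ ^ 3 + 4 * κ ^ 2 + 5 * κ := by
  rcases hs.eq_or_lt with rfl | hs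
  · positivity
  have hm' : m ≤ κ * U := by
    refine abs_le_of_sq_le_sq' ?_ (by positivity) |>.2
    nlinarith [sq_nonneg U, mul_nonneg (sub_nonneg.2 hκ) (mul_nonneg (by linarith : 0 ≤ κ) (sq_nonneg U))]
  have h5 : s * U ^ 2 ≤ (m + U) * p + (2 * μ + p + U) * m := by
    refine le_of_mul_le_mul_left ?_ hs
    nlinarith
  have h6 : (m + U) * p ≤ (κ * U + U) * (κ * U) := by gcongr
  have h7 : (2 * μ + p + U) * m ≤ (2 * μ + κ * U + U) * (κ * U) := by gcongr
  have h8 : μ ^ 2 ≤ κ ^ 2 * U ^ 2 + 2 * s * κ * U ^ 2 := by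
    have e1 : μ * p ≤ μ * (κ * U) := by gcongr
    have e2 : s * m * U ≤ s * (κ * U) * U := by gcongr
    nlinarith [sq_nonneg (μ - κ * U)]
  -- Young's inequality with weight `4κ`, chosen so that the `s` term of `h8` returns as `s / 2` and
  -- is absorbed.
  have h9 : 2 * μ * (κ * U) * (4 * κ) ≤ μ ^ 2 + 16 * κ ^ 4 * U ^ 2 := by
    nlinarith [sq_nonneg (μ - 4 * κ ^ 2 * U)]
  have h10 : 2 * μ * (κ * U) ≤ (κ / 4 + s / 2 + 4 * κ ^ 3) * U ^ 2 := by
    refine le_of_mul_le_mul_right (a := 4 * κ) ?_ (by positivity)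
    nlinarith
  have h11 : s * U ^ 2 ≤ (2 * κ ^ 2 + 2 * κ + κ / 4 + s / 2 + 4 * κ ^ 3) * U ^ 2 := by nlinarith
  have := le_of_mul_le_mul_right h11 (by positivity)
  nlinarith

/-- Subelliptic estimate: an approximate eigenvector at `z` only exists at bounded frequency. -/
theorem IsLadder.frequency_bound {ι : S →ₗ[ℂ] H} {b b' : Fin n → S →ₗ[ℂ] S}
    (h : IsLadder ι b b') (ξ : EuclideanSpace ℝ (Fin n)) (z : ℂ) (f : S) (hf : ι f ≠ 0)
    (hle : ‖ι (numberOp b b' f + Complex.I • (contractOp b ξ f + contractOp b' ξ f) - z • f)‖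
      ≤ ‖ι f‖) :
    ‖ξ‖ ≤ 8 * (1 + ‖z‖) ^ 3 + 4 * (1 + ‖z‖) ^ 2 + 5 * (1 + ‖z‖) := by
  set N := numberOp b b'
  set A := contractOp b ξ
  set A' := contractOp b' ξ
  set P := N f + Complex.I • (A f + A' f) with hP
  set m := √(∑ j, ‖ι (b j f)‖ ^ 2) with hmdef
  have hm2 : m ^ 2 = ∑ j, ‖ι (b j f)‖ ^ 2 := Real.sq_sqrt (by positivity)
  have hm : 0 ≤ m := Real.sqrt_nonneg _
  have hA : ‖ι (A f)‖ ≤ ‖ξ‖ * m := IsLadder.norm_contract_le ι b ξ f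
  have hA' : ‖ι (A' f)‖ ≤ ‖ξ‖ * (m + ‖ι f‖) := by
    refine abs_le_of_sq_le_sq' ?_ (by positivity) |>.2
    rw [h.norm_contract_create_sq]
    have := pow_le_pow_left₀ (norm_nonneg _) hA 2
    nlinarith [mul_nonneg (mul_nonneg hm (norm_nonneg (ι f))) (sq_nonneg ‖ξ‖)]
  have hp : ‖ι P‖ ≤ (1 + ‖z‖) * ‖ι f‖ := by
    have : ι P = ι (P - z • f) + z • ι f := by simp
    rw [this]
    refine (norm_add_le _ _).trans ?_
    rw [norm_smul]
    linarith
  have adjA : ∀ x y, ⟪ι (A x), ι y⟫_ℂ = ⟪ι x, ι (A' y)⟫_ℂ := h.contract_adj ξ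
  have adjA' : ∀ x y, ⟪ι (A' x), ι y⟫_ℂ = ⟪ι x, ι (A y)⟫_ℂ := fun x y => by
    rw [← inner_conj_symm, ← adjA, inner_conj_symm]
  -- `i (A + A')` is skew-adjoint, so only `N` contributes to the real part of `⟪f, P f⟫`.
  have h2 : m ^ 2 ≤ ‖ι f‖ * ‖ι P‖ := by
    have e : (⟪ι f, ι P⟫_ℂ).re = m ^ 2 := by
      have c : ⟪ι f, ι (A' f)⟫_ℂ = (starRingEnd ℂ) ⟪ι f, ι (A f)⟫_ℂ := by
        rw [inner_conj_symm, adjA]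
      rw [hP, map_add, map_smul, map_add, inner_add_right, inner_smul_right, inner_add_right,
        h.inner_numberOp_self, c, Complex.add_conj, ← hm2]
      simp [-Complex.ofReal_pow, -Complex.ofReal_mul]
    rw [← e]
    exact (Complex.re_le_norm _).trans (norm_inner_le_norm _ _)
  -- Since `[A, N] = A`, the skew part contributes only a multiple of `⟪A f, f⟫` to the real part of
  -- `⟪N f, P f⟫`.
  have h3 : ‖ι (N f)‖ ^ 2 ≤ ‖ι (N f)‖ * ‖ι P‖ + ‖ξ‖ * m * ‖ι f‖ := by
    have c : ⟪ι (N f), ι (A' f)⟫_ℂ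
        = (starRingEnd ℂ) ⟪ι (N f), ι (A f)⟫_ℂ + ⟪ι (A f), ι f⟫_ℂ := by
      rw [← adjA, h.contract_numberOp, map_add, inner_add_left, h.numberOp_symm, inner_conj_symm]
    have e : (⟪ι (N f), ι P⟫_ℂ).re = ‖ι (N f)‖ ^ 2 - (⟪ι (A f), ι f⟫_ℂ).im := by
      rw [hP, map_add, map_smul, map_add, inner_add_right, inner_smul_right, inner_add_right,
        c, ← add_assoc, Complex.add_conj, inner_self_eq_norm_sq_to_K]
      simp [← Complex.ofReal_pow, -Complex.ofReal_mul]
      ring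
    have e1 := (Complex.re_le_norm _).trans (norm_inner_le_norm (𝕜 := ℂ) (ι (N f)) (ι P))
    have e2 := (Complex.im_le_norm _).trans (norm_inner_le_norm (𝕜 := ℂ) (ι (A f)) (ι f))
    have e3 : ‖ι (A f)‖ * ‖ι f‖ ≤ ‖ξ‖ * m * ‖ι f‖ := by gcongr
    linarith
  -- The gain in frequency: `[A, P] = A + i|ξ|²` because `[A, A'] = |ξ|²`, and pairing with `f`
  -- isolates `|ξ|²‖f‖²`. In `c3`, `2N - P` is the formal adjoint of `P`.
  have h4 : ‖ξ‖ ^ 2 * ‖ι f‖ ^ 2 ≤ ‖ξ‖ * (m + ‖ι f‖) * ‖ι P‖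
      + (2 * ‖ι (N f)‖ + ‖ι P‖) * (‖ξ‖ * m) + ‖ι f‖ * (‖ξ‖ * m) := by
    have c1 : A P = N (A f) + A f + Complex.I • (A (A f) + A' (A f))
        + (Complex.I * ((‖ξ‖ ^ 2 : ℝ) : ℂ)) • f := by
      rw [hP, map_add, map_smul, map_add, h.contract_numberOp, h.contract_contract]
      module
    have c2 : ⟪ι f, ι (A P)⟫_ℂ = ⟪ι (A' f), ι P⟫_ℂ := (adjA' _ _).symm
    have c3 : ⟪ι f, ι (N (A f) + Complex.I • (A (A f) + A' (A f)))⟫_ℂ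
        = ⟪(2 : ℂ) • ι (N f) - ι P, ι (A f)⟫_ℂ := by
      have : (2 : ℂ) • ι (N f) - ι P = ι (N f) - Complex.I • (ι (A f) + ι (A' f)) := by
        rw [hP, map_add, map_smul, map_add]; module
      rw [this, inner_sub_left, inner_smul_left, inner_add_left, map_add, map_smul, map_add,
        inner_add_right, inner_smul_right, inner_add_right, h.numberOp_symm, adjA', adjA]
      simp
      ring
    have c4 : Complex.I * ((‖ξ‖ ^ 2 * ‖ι f‖ ^ 2 : ℝ) : ℂ) = ⟪ι (A' f), ι P⟫_ℂ
        - ⟪(2 : ℂ) • ι (N f) - ι P, ι (A f)⟫_ℂ - ⟪ι f, ι (A f)⟫_ℂ := by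
      rw [← c2, ← c3, c1]
      simp only [map_add, map_smul, inner_add_right, inner_smul_right, inner_self_eq_ofReal]
      push_cast
      ring
    have c5 : ‖Complex.I * ((‖ξ‖ ^ 2 * ‖ι f‖ ^ 2 : ℝ) : ℂ)‖ = ‖ξ‖ ^ 2 * ‖ι f‖ ^ 2 := by
      rw [norm_mul, Complex.norm_I, one_mul, Complex.norm_real, Real.norm_of_nonneg (by positivity)]
    rw [← c5, c4]
    refine (norm_sub_le _ _).trans (add_le_add ((norm_sub_le _ _).trans (add_le_add ?_ ?_)) ?_)
    · exact (norm_inner_le_norm _ _).trans (by gcongr)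
    · refine (norm_inner_le_norm _ _).trans ?_
      gcongr
      refine (norm_sub_le _ _).trans ?_
      rw [norm_smul]
      simp
    · exact (norm_inner_le_norm _ _).trans (by gcongr)
  refine frequency_bound_of_inequalities (norm_nonneg _) (norm_pos_iff.2 hf) hm
    (norm_nonneg (ι (N f))) (norm_nonneg (ι P)) (by linarith [norm_nonneg z]) hp ?_ h3 h4
  calc m ^ 2 ≤ ‖ι f‖ * ‖ι P‖ := h2
    _ ≤ ‖ι f‖ * ((1 + ‖z‖) * ‖ι f‖) := by gcongr
    _ = _ := by ring

end Ladder

/-! ### Uniform lower bound for the fibre operators -/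

/-- An `ℓ²` bound for finitely supported solutions of a two-term descending recursion whose
coupling is eventually at most `1 / 2`. -/
theorem sum_le_of_descending_recursion {A R : ℝ} (hA : 0 ≤ A) (hR : 1 ≤ 2 * R) (K m : ℕ)
    (X Y r : ℕ → ℝ) (hX : ∀ k, 0 ≤ X k) (hY : ∀ k, 0 ≤ Y k) (hXm : X m = 0)
    (hr : ∀ k, r k ≤ R) (hr' : ∀ k, K ≤ k → r k ≤ 1 / 2)
    (h : ∀ k, X k ≤ A * Y k + r k * X (k + 1)) :
    ∑ k ∈ Finset.range m, X k ≤ 2 * A * (2 * R) ^ K * ∑ k ∈ Finset.range m, Y k := by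
  -- Weights growing by the factor `2R` up to level `K` compensate the large couplings: `w k * r k ≤
  -- w (k + 1) / 2` at every level, so half of the weighted sum can be absorbed.
  set w : ℕ → ℝ := fun k => (2 * R) ^ (min k K) with hw
  have hw1 : ∀ k, 1 ≤ w k := fun k => one_le_pow₀ hR
  have hwK : ∀ k, w k ≤ (2 * R) ^ K := fun k => pow_le_pow_right₀ hR (min_le_right _ _)
  have hwr : ∀ k, w k * r k ≤ w (k + 1) / 2 := by
    intro k
    rcases le_or_gt K k with hk | hk
    · simp only [hw, min_eq_right hk, min_eq_right (hk.trans k.le_succ)]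
      have : (0 : ℝ) ≤ (2 * R) ^ K := by positivity
      nlinarith [hr' k hk]
    · simp only [hw, min_eq_left hk.le, min_eq_left (Nat.succ_le_of_lt hk), pow_succ]
      have : (0 : ℝ) ≤ (2 * R) ^ k := by positivity
      nlinarith [hr k]
  have h1 : ∀ k, w k * X k ≤ A * (2 * R) ^ K * Y k + (w (k + 1) * X (k + 1)) / 2 := by
    intro k
    have e1 := mul_le_mul_of_nonneg_left (h k) (zero_le_one.trans (hw1 k))
    have e2 := mul_le_mul_of_nonneg_right (hwr k) (hX (k + 1))
    have e3 := mul_le_mul_of_nonneg_right (hwK k) (mul_nonneg hA (hY k))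
    linarith
  have h2 := Finset.sum_le_sum fun k (_ : k ∈ Finset.range m) => h1 k
  rw [Finset.sum_add_distrib, ← Finset.mul_sum, ← Finset.sum_div] at h2
  -- The index shift costs nothing: `X m = 0` at the top, and the dropped bottom term is
  -- nonnegative.
  have h3 : ∑ k ∈ Finset.range m, w (k + 1) * X (k + 1) ≤ ∑ k ∈ Finset.range m, w k * X k := by
    have e := Finset.sum_range_succ' (fun k => w k * X k) m
    rw [Finset.sum_range_succ, hXm] at e
    have := mul_nonneg (zero_le_one.trans (hw1 0)) (hX 0)
    linarith
  have h4 : ∑ k ∈ Finset.range m, X k ≤ ∑ k ∈ Finset.range m, w k * X k :=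
    Finset.sum_le_sum fun k _ => le_mul_of_one_le_left (hX k) (hw1 k)
  linarith

/-- A point off the half-line `[0, ∞)` has positive distance to it. -/
theorem exists_dist_halfLine_pos {z : ℂ} (hz : ¬ (0 ≤ z.re ∧ z.im = 0)) :
    ∃ δ > 0, ∀ t : ℝ, 0 ≤ t → δ ≤ ‖(t : ℂ) - z‖ := by
  by_cases him : z.im = 0
  · have hre : z.re < 0 := lt_of_not_ge fun h => hz ⟨h, him⟩
    refine ⟨-z.re, by linarith, fun t ht => le_trans ?_ (Complex.re_le_norm _)⟩
    simp only [Complex.sub_re, Complex.ofReal_re]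
    linarith
  · refine ⟨|z.im|, abs_pos.2 him, fun t _ => le_trans ?_ (Complex.abs_im_le_norm _)⟩
    simp

/-- The graded estimate with constants uniform for `s ≤ S`. -/
theorem exists_graded_bound {δ : ℝ} (hδ : 0 < δ) (S Z : ℝ) :
    ∃ C > 0, ∀ (m : ℕ) (s : ℝ) (d x y : ℕ → ℝ), 0 ≤ s → s ≤ S → (∀ k, 0 ≤ x k) →
      (∀ k, 0 ≤ y k) → x m = 0 → (∀ k, δ ≤ d k) → (∀ k : ℕ, (k : ℝ) - Z ≤ d k) →
      (∀ k, d k * x k ≤ y k + 2 * (s * √((k + 1 : ℕ) : ℝ) * x (k + 1))) →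
      ∑ k ∈ Finset.range m, x k ^ 2 ≤ C * ∑ k ∈ Finset.range m, y k ^ 2 := by
  -- For `k ≥ K`, `2|Z| ≤ k` gives `d k ≥ k / 2` and `64 s² ≤ k - 1` gives `16 s² (k + 1) ≤ k² / 4`,
  -- so the squared coupling is at most `1 / 2`.
  obtain ⟨K, hK⟩ := exists_nat_ge (2 * |Z| + 64 * S ^ 2 + 1)
  set R : ℝ := 8 * S ^ 2 * (K + 1) / δ ^ 2 + 1 / 2 with hR
  have hR' : 1 ≤ 2 * R := by
    have : 0 ≤ 8 * S ^ 2 * (K + 1) / δ ^ 2 := by positivity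
    rw [hR]; linarith
  refine ⟨2 * (2 / δ ^ 2) * (2 * R) ^ K, by positivity,
    fun m s d x y hs hsS hx hy hxm hd hd' h => ?_⟩
  have hd0 : ∀ k, 0 < d k := fun k => hδ.trans_le (hd k)
  have hsS2 : s ^ 2 ≤ S ^ 2 := pow_le_pow_left₀ hs hsS 2
  have hlarge : ∀ k, K ≤ k → 8 * s ^ 2 * (k + 1) / d k ^ 2 ≤ 1 / 2 := by
    intro k hk
    rw [div_le_div_iff₀ (pow_pos (hd0 k) 2) two_pos]
    have hk' : (K : ℝ) ≤ k := by exact_mod_cast hk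
    have e1 : (k : ℝ) / 2 ≤ d k := by linarith [hd' k, le_abs_self Z, sq_nonneg S]
    have e2 : ((k : ℝ) / 2) ^ 2 ≤ d k ^ 2 := pow_le_pow_left₀ (by positivity) e1 2
    have e3 : 64 * s ^ 2 ≤ k - 1 := by linarith [abs_nonneg Z]
    nlinarith [sq_nonneg s]
  refine sum_le_of_descending_recursion (by positivity) hR' K m (fun k => x k ^ 2)
    (fun k => y k ^ 2) (fun k => 8 * s ^ 2 * (k + 1) / d k ^ 2) (fun k => sq_nonneg _)
    (fun k => sq_nonneg _) (by simp [hxm]) ?_ hlarge ?_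
  · intro k
    rcases le_or_gt K k with hk | hk
    · exact (hlarge k hk).trans (by linarith)
    · have hk' : (k : ℝ) ≤ K := by exact_mod_cast hk.le
      calc 8 * s ^ 2 * (k + 1) / d k ^ 2 ≤ 8 * S ^ 2 * (K + 1) / δ ^ 2 := by
            gcongr
            exact hd k
        _ ≤ R := by rw [hR]; linarith
  · intro k
    have e1 := pow_le_pow_left₀ (mul_nonneg (hd0 k).le (hx k)) (h k) 2
    have e2 : (√((k + 1 : ℕ) : ℝ)) ^ 2 = k + 1 := by
      rw [Real.sq_sqrt (by positivity)]; push_cast; ring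
    have e3 : (d k * x k) ^ 2 ≤ 2 * y k ^ 2 + 8 * s ^ 2 * (k + 1) * x (k + 1) ^ 2 := by
      have : (2 * (s * √((k + 1 : ℕ) : ℝ) * x (k + 1))) ^ 2
          = 4 * s ^ 2 * (k + 1) * x (k + 1) ^ 2 := by rw [← e2]; ring
      nlinarith [sq_nonneg (y k - 2 * (s * √((k + 1 : ℕ) : ℝ) * x (k + 1)))]
    have e4 : x k ^ 2 ≤ (2 * y k ^ 2) / d k ^ 2
        + 8 * s ^ 2 * (k + 1) / d k ^ 2 * x (k + 1) ^ 2 := by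
      rw [div_mul_eq_mul_div, ← add_div, le_div_iff₀ (pow_pos (hd0 k) 2)]
      linarith
    refine e4.trans (add_le_add ?_ le_rfl)
    rw [mul_div_right_comm]
    gcongr
    exact hd k

/-! ### Grading by the number operator and the uniform bound. -/

section Ladder

variable {S H : Type*} [AddCommGroup S] [Module ℂ S] [NormedAddCommGroup H]
  [InnerProductSpace ℂ H] {n : ℕ} {ι : S →ₗ[ℂ] H} {a a' : Fin n → S →ₗ[ℂ] S}

/-- The `k`-th eigenspace of the number operator. -/
def levelSpace (a a' : Fin n → S →ₗ[ℂ] S) (k : ℕ) : Submodule ℂ S :=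
  Module.End.eigenspace (numberOp a a') (k : ℂ)

theorem mem_levelSpace {k : ℕ} {f : S} :
    f ∈ levelSpace a a' k ↔ numberOp a a' f = (k : ℂ) • f :=
  Module.End.mem_eigenspace_iff

namespace IsLadder

theorem annihilate_mem_levelSpace (h : IsLadder ι a a') {k : ℕ} {f : S}
    (hf : f ∈ levelSpace a a' (k + 1)) (j : Fin n) : a j f ∈ levelSpace a a' k := by
  rw [mem_levelSpace] at hf ⊢
  have := h.annihilate_numberOp j f
  rw [hf, map_smul] at this
  rw [eq_sub_of_add_eq this.symm]
  push_cast
  module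

theorem create_mem_levelSpace (h : IsLadder ι a a') {k : ℕ} {f : S}
    (hf : f ∈ levelSpace a a' k) (j : Fin n) : a' j f ∈ levelSpace a a' (k + 1) := by
  rw [mem_levelSpace] at hf ⊢
  rw [h.numberOp_create, hf, map_smul]
  push_cast
  module

/-- Both sides compute `⟪f, N f⟫`. -/
theorem sum_norm_annihilate_sq (h : IsLadder ι a a') {k : ℕ} {f : S}
    (hf : f ∈ levelSpace a a' k) : ∑ j, ‖ι (a j f)‖ ^ 2 = k * ‖ι f‖ ^ 2 := by
  have := h.inner_numberOp_self f
  rw [mem_levelSpace.1 hf, map_smul, inner_smul_right, inner_self_eq_ofReal] at this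
  exact_mod_cast this.symm

theorem map_annihilate_eq_zero (h : IsLadder ι a a') {f : S} (hf : f ∈ levelSpace a a' 0)
    (j : Fin n) : ι (a j f) = 0 := by
  have := h.sum_norm_annihilate_sq hf
  simp only [Nat.cast_zero, zero_mul] at this
  have := (Finset.sum_eq_zero_iff_of_nonneg (fun _ _ => sq_nonneg _)).1 this j (Finset.mem_univ _)
  simpa using this

theorem norm_contract_le_of_mem (h : IsLadder ι a a') {k : ℕ} {f : S}
    (hf : f ∈ levelSpace a a' k) (ξ : EuclideanSpace ℝ (Fin n)) :
    ‖ι (contractOp a ξ f)‖ ≤ ‖ξ‖ * √(k : ℝ) * ‖ι f‖ := by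
  refine (norm_contract_le ι a ξ f).trans_eq ?_
  rw [h.sum_norm_annihilate_sq hf, Real.sqrt_mul (Nat.cast_nonneg _),
    Real.sqrt_sq (norm_nonneg _), mul_assoc]

theorem contract_mem_levelSpace (h : IsLadder ι a a') {k : ℕ} {f : S}
    (hf : f ∈ levelSpace a a' (k + 1)) (ξ : EuclideanSpace ℝ (Fin n)) :
    contractOp a ξ f ∈ levelSpace a a' k := by
  rw [contractOp_apply]
  exact Submodule.sum_mem _ fun j _ =>
    Submodule.smul_mem _ _ (h.annihilate_mem_levelSpace hf j)

theorem inner_eq_zero_of_levelSpace (h : IsLadder ι a a') {k l : ℕ} (hkl : k ≠ l) {f g : S}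
    (hf : f ∈ levelSpace a a' k) (hg : g ∈ levelSpace a a' l) : ⟪ι f, ι g⟫_ℂ = 0 := by
  have := h.numberOp_symm f g
  rw [mem_levelSpace.1 hf, mem_levelSpace.1 hg, map_smul, map_smul, inner_smul_left,
    inner_smul_right, Complex.conj_natCast] at this
  have h0 : ((k : ℂ) - l) * ⟪ι f, ι g⟫_ℂ = 0 := by rw [sub_mul, this, sub_self]
  exact (mul_eq_zero.1 h0).resolve_left (sub_ne_zero.2 (by exact_mod_cast hkl))

theorem norm_sum_levelSpace_sq (h : IsLadder ι a a') (s : Finset ℕ) (F : ℕ → S)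
    (hF : ∀ k, F k ∈ levelSpace a a' k) :
    ‖ι (∑ k ∈ s, F k)‖ ^ 2 = ∑ k ∈ s, ‖ι (F k)‖ ^ 2 := by
  have : ⟪ι (∑ k ∈ s, F k), ι (∑ k ∈ s, F k)⟫_ℂ = ∑ k ∈ s, ⟪ι (F k), ι (F k)⟫_ℂ := by
    rw [map_sum, sum_inner]
    refine Finset.sum_congr rfl fun k hk => ?_
    rw [inner_sum, Finset.sum_eq_single_of_mem k hk]
    exact fun l _ hl => h.inner_eq_zero_of_levelSpace hl.symm (hF k) (hF l)
  simp only [inner_self_eq_ofReal] at this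
  exact_mod_cast this

/-- At bounded frequency the fibre operators are uniformly bounded below on finite sums of
eigenvectors of the number operator. -/
theorem lower_bound_of_norm_le (h : IsLadder ι a a') {z : ℂ} (hz : ¬ (0 ≤ z.re ∧ z.im = 0))
    (Ξ : ℝ) : ∃ C > 0, ∀ ξ : EuclideanSpace ℝ (Fin n), ‖ξ‖ ≤ Ξ →
      ∀ f ∈ ⨆ k, levelSpace a a' k, ‖ι f‖ ^ 2 ≤ C * ‖ι (fibreOp a a' ξ f - z • f)‖ ^ 2 := by
  obtain ⟨δ, hδ, hdist⟩ := exists_dist_halfLine_pos hz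
  obtain ⟨C, hC, hgr⟩ := exists_graded_bound hδ Ξ ‖z‖
  refine ⟨C, hC, fun ξ hξ f hf => ?_⟩
  obtain ⟨F, hF, rfl⟩ := (Submodule.mem_iSup_iff_exists_finsupp _ _).1 hf
  obtain ⟨m, hm⟩ : ∃ m, F.support ⊆ Finset.range m := F.support.exists_nat_subset_range
  have hFm : ∀ k, m ≤ k → F k = 0 := fun k hk => by
    by_contra h0
    exact absurd (Finset.mem_range.1 (hm (Finsupp.mem_support_iff.2 h0))) (not_lt.2 hk)
  have hsum : (F.sum fun _ x => x) = ∑ k ∈ Finset.range m, F k :=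
    Finsupp.sum_of_support_subset F hm _ (fun _ _ => rfl)
  rw [hsum]
  set c : ℕ → ℂ := fun k => (((k : ℝ) + ‖ξ‖ ^ 2 : ℝ) : ℂ) - z with hc
  -- The level-`k` component of the image: the contraction lowers the level by one.
  set G : ℕ → S := fun k => c k • F k + (2 * Complex.I) • contractOp a ξ (F (k + 1)) with hG
  have hGm : ∀ k, G k ∈ levelSpace a a' k := fun k =>
    Submodule.add_mem _ (Submodule.smul_mem _ _ (hF k))
      (Submodule.smul_mem _ _ (h.contract_mem_levelSpace (hF (k + 1)) ξ))
  have hLG : ι (fibreOp a a' ξ (∑ k ∈ Finset.range m, F k) - z • ∑ k ∈ Finset.range m, F k)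
      = ι (∑ k ∈ Finset.range m, G k) := by
    -- Reindexing is exact: `F m = 0`, and the contraction of level zero vanishes in `H`, even if
    -- `ι` is not injective.
    have e1 : ∑ k ∈ Finset.range m, ι (contractOp a ξ (F k))
        = ∑ k ∈ Finset.range m, ι (contractOp a ξ (F (k + 1))) := by
      have e0 : ι (contractOp a ξ (F 0)) = 0 := by
        have := h.norm_contract_le_of_mem (hF 0) ξ
        simpa using this
      have := Finset.sum_range_succ' (fun k => ι (contractOp a ξ (F k))) m
      rw [Finset.sum_range_succ, hFm m le_rfl, e0] at this
      simpa using this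
    have e2 : ∀ k, numberOp a a' (F k) = (k : ℂ) • F k := fun k => mem_levelSpace.1 (hF k)
    simp only [fibreOp_apply, map_sub, map_add, map_sum, map_smul, e2, e1, hG, hc,
      Finset.sum_add_distrib, ← Finset.smul_sum]
    simp only [add_smul, sub_smul, Complex.ofReal_add, Finset.sum_add_distrib,
      Finset.sum_sub_distrib, ← Finset.smul_sum, Complex.ofReal_natCast]
    abel
  rw [hLG, h.norm_sum_levelSpace_sq _ _ hF, h.norm_sum_levelSpace_sq _ _ hGm]
  refine hgr m ‖ξ‖ (fun k => ‖c k‖) (fun k => ‖ι (F k)‖) (fun k => ‖ι (G k)‖) (norm_nonneg _) hξ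
    (fun _ => norm_nonneg _) (fun _ => norm_nonneg _) (by simp [hFm m le_rfl])
    (fun k => hdist _ (by positivity)) (fun k => ?_) (fun k => ?_)
  · have e1 : ‖(((k : ℝ) + ‖ξ‖ ^ 2 : ℝ) : ℂ)‖ - ‖z‖ ≤ ‖c k‖ := norm_sub_norm_le _ _
    rw [Complex.norm_real, Real.norm_of_nonneg (by positivity)] at e1
    nlinarith [sq_nonneg ‖ξ‖]
  · have e1 : c k • ι (F k) = ι (G k) - (2 * Complex.I) • ι (contractOp a ξ (F (k + 1))) := by
      simp [hG]
    rw [← norm_smul, e1]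
    refine (norm_sub_le _ _).trans (add_le_add le_rfl ?_)
    rw [norm_smul]
    have := h.norm_contract_le_of_mem (hF (k + 1)) ξ
    simpa using this

/-- The fibre operators are bounded below, uniformly in the frequency. -/
theorem lower_bound (h : IsLadder ι a a') {z : ℂ} (hz : ¬ (0 ≤ z.re ∧ z.im = 0)) :
    ∃ C > 0, ∀ ξ : EuclideanSpace ℝ (Fin n),
      ∀ f ∈ ⨆ k, levelSpace a a' k, ‖ι f‖ ^ 2 ≤ C * ‖ι (fibreOp a a' ξ f - z • f)‖ ^ 2 := by
  obtain ⟨C, hC, hb⟩ := h.lower_bound_of_norm_le hz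
    (8 * (1 + ‖z‖) ^ 3 + 4 * (1 + ‖z‖) ^ 2 + 5 * (1 + ‖z‖))
  -- `C` serves approximate eigenvectors, whose frequency lies below the threshold; `1` serves the
  -- case where the residual already exceeds `‖ι f‖`.
  refine ⟨max C 1, by positivity, fun ξ f hf => ?_⟩
  by_cases hle : ‖ι (fibreOp a a' ξ f - z • f)‖ ≤ ‖ι f‖
  · by_cases h0 : ι f = 0
    · rw [h0, norm_zero, zero_pow two_ne_zero]
      exact mul_nonneg (by positivity) (sq_nonneg _)
    · rw [fibreOp_eq_shift] at hle
      refine (hb ξ ((h.shift ξ).frequency_bound ξ z f h0 hle) f hf).trans ?_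
      gcongr
      exact le_max_left _ _
  · have := pow_le_pow_left₀ (norm_nonneg _) (not_le.1 hle).le 2
    refine this.trans (le_mul_of_one_le_left (sq_nonneg _) (le_max_right _ _))

end IsLadder

end Ladder

/-! ### Schwartz functions: Gaussians, tensor products, Fourier multipliers -/

section Gaussian

variable {E : Type*} [NormedAddCommGroup E] [InnerProductSpace ℝ E]

/-- `(1 + r)^K ≤ K! e^{1 + r}`, and `1 + r - r²/4 ≤ 2` by completing the square. -/
theorem one_add_pow_mul_exp_le (K : ℕ) {r : ℝ} (hr : 0 ≤ r) :
    (1 + r) ^ K * Real.exp (-(r ^ 2 / 4)) ≤ K.factorial * Real.exp 2 := by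
  have h1 : (1 + r) ^ K ≤ K.factorial * Real.exp (1 + r) := by
    have := Real.pow_div_factorial_le_exp (1 + r) (by positivity) K
    rwa [div_le_iff₀ (by positivity), mul_comm] at this
  calc (1 + r) ^ K * Real.exp (-(r ^ 2 / 4))
      ≤ (K.factorial * Real.exp (1 + r)) * Real.exp (-(r ^ 2 / 4)) := by gcongr
    _ = K.factorial * Real.exp (1 + r + -(r ^ 2 / 4)) := by rw [Real.exp_add (1 + r)]; ring
    _ ≤ K.factorial * Real.exp 2 := by
      gcongr
      nlinarith [sq_nonneg (r - 2)]

variable (E) in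
/-- The Gaussian `exp (-|v|² / 4)` as a real Schwartz function. -/
def realGaussian : 𝓢(E, ℝ) where
  toFun v := Real.exp (-(‖v‖ ^ 2 / 4))
  smooth' := Real.contDiff_exp.comp ((contDiff_norm_sq ℝ).div_const 4).neg
  decay' k m := by
    have hq : (fun v : E => -(‖v‖ ^ 2 / 4)).HasTemperateGrowth := by
      have : (fun v : E => -(‖v‖ ^ 2 / 4)) = fun v => (-(1 / 4) : ℝ) * ‖v‖ ^ 2 := by
        ext v; ring
      rw [this]
      fun_prop
    obtain ⟨l, C, hC, hb⟩ := hq.norm_iteratedFDeriv_le_uniform m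
    refine ⟨m.factorial * (C + 1) ^ m * ((k + l * m).factorial * Real.exp 2), fun v => ?_⟩
    -- Faà di Bruno bound: all derivatives of `exp` equal `exp`, and the exponent has polynomially
    -- bounded derivatives. Using `C + 1` makes the base at least `1`, hence at most its `i`-th
    -- power for `i ≥ 1`.
    have h1 : ‖iteratedFDeriv ℝ m (Real.exp ∘ fun v : E => -(‖v‖ ^ 2 / 4)) v‖
        ≤ m.factorial * Real.exp (-(‖v‖ ^ 2 / 4)) * ((C + 1) * (1 + ‖v‖) ^ l) ^ m := by
      refine norm_iteratedFDeriv_comp_le (N := ∞) Real.contDiff_exp hq.1 (mod_cast le_top) v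
        (fun i _ => ?_) (fun i hi him => ?_)
      · rw [norm_iteratedFDeriv_eq_norm_iteratedDeriv, iteratedDeriv_eq_iterate,
          Real.iter_deriv_exp, Real.norm_of_nonneg (Real.exp_pos _).le]
      · refine (hb i him v).trans ((?_ : _ ≤ (C + 1) * (1 + ‖v‖) ^ l).trans
          (le_self_pow₀ ?_ (by omega)))
        · gcongr; linarith
        · exact one_le_mul_of_one_le_of_one_le (by linarith)
            (one_le_pow₀ (by linarith [norm_nonneg v]))
    calc ‖v‖ ^ k * ‖iteratedFDeriv ℝ m (fun v : E => Real.exp (-(‖v‖ ^ 2 / 4))) v‖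
        ≤ (1 + ‖v‖) ^ k * (m.factorial * Real.exp (-(‖v‖ ^ 2 / 4))
            * ((C + 1) * (1 + ‖v‖) ^ l) ^ m) := by
          gcongr
          · linarith
          · exact h1
      _ = m.factorial * (C + 1) ^ m * ((1 + ‖v‖) ^ (k + l * m)
            * Real.exp (-(‖v‖ ^ 2 / 4))) := by rw [mul_pow, ← pow_mul, pow_add]; ring
      _ ≤ _ :=
        mul_le_mul_of_nonneg_left (one_add_pow_mul_exp_le _ (norm_nonneg v)) (by positivity)

variable (E) in
/-- The Gaussian `exp (-|v|² / 4)` as a complex Schwartz function. -/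
def gaussian : 𝓢(E, ℂ) := (realGaussian E).postcompCLM Complex.ofRealCLM

theorem gaussian_apply (v : E) : gaussian E v = ((Real.exp (-(‖v‖ ^ 2 / 4)) : ℝ) : ℂ) := rfl

end Gaussian

section Tensor

variable {E F G : Type*} [NormedAddCommGroup E] [NormedSpace ℝ E] [NormedAddCommGroup F]
  [NormedSpace ℝ F] [NormedAddCommGroup G] [NormedSpace ℝ G]

theorem iteratedFDeriv_schwartz_comp_le (A : E →L[ℝ] F) (φ : 𝓢(F, ℂ)) (k i : ℕ) (p : E) :
    ‖A p‖ ^ k * ‖iteratedFDeriv ℝ i (fun q => φ (A q)) p‖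
      ≤ ‖A‖ ^ i * SchwartzMap.seminorm ℝ k i φ := by
  have h1 : ‖iteratedFDeriv ℝ i (φ ∘ A) p‖ ≤ ‖iteratedFDeriv ℝ i φ (A p)‖ * ‖A‖ ^ i := by
    rw [A.iteratedFDeriv_comp_right (φ.smooth ⊤) p (mod_cast le_top)]
    refine (ContinuousMultilinearMap.norm_compContinuousLinearMap_le _ _).trans_eq ?_
    simp
  calc ‖A p‖ ^ k * ‖iteratedFDeriv ℝ i (fun q => φ (A q)) p‖
      ≤ ‖A p‖ ^ k * (‖iteratedFDeriv ℝ i φ (A p)‖ * ‖A‖ ^ i) := by gcongr; exact h1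
    _ = ‖A‖ ^ i * (‖A p‖ ^ k * ‖iteratedFDeriv ℝ i φ (A p)‖) := by ring
    _ ≤ _ := by
      gcongr
      exact SchwartzMap.le_seminorm ℝ k i φ (A p)

/-- The product `φ(A p) h(B p)` of two Schwartz functions along linear maps which together are
bounded below. -/
def tensorAlong (A : E →L[ℝ] F) (B : E →L[ℝ] G) {K : ℝ} (hK : 0 ≤ K)
    (hAB : ∀ p, ‖p‖ ≤ K * (‖A p‖ + ‖B p‖)) (φ : 𝓢(F, ℂ)) (h : 𝓢(G, ℂ)) : 𝓢(E, ℂ) where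
  toFun p := φ (A p) * h (B p)
  smooth' := ((φ.smooth ⊤).comp A.contDiff).mul ((h.smooth ⊤).comp B.contDiff)
  decay' k m := by
    refine ⟨K ^ k * 2 ^ (k - 1) * ∑ i ∈ Finset.range (m + 1), m.choose i *
      ((‖A‖ ^ i * SchwartzMap.seminorm ℝ k i φ) * (‖B‖ ^ (m - i) * SchwartzMap.seminorm ℝ 0 (m - i) h)
      + (‖A‖ ^ i * SchwartzMap.seminorm ℝ 0 i φ)
        * (‖B‖ ^ (m - i) * SchwartzMap.seminorm ℝ k (m - i) h)), fun p => ?_⟩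
    -- The weight `‖p‖^k` is split so that one factor carries the power `k` and the other the power
    -- `0`.
    have hp : ‖p‖ ^ k ≤ K ^ k * 2 ^ (k - 1) * (‖A p‖ ^ k + ‖B p‖ ^ k) := by
      calc ‖p‖ ^ k ≤ (K * (‖A p‖ + ‖B p‖)) ^ k := by gcongr; exact hAB p
        _ = K ^ k * (‖A p‖ + ‖B p‖) ^ k := mul_pow _ _ _
        _ ≤ K ^ k * (2 ^ (k - 1) * (‖A p‖ ^ k + ‖B p‖ ^ k)) := by
          gcongr
          exact add_pow_le (norm_nonneg _) (norm_nonneg _) k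
        _ = _ := by ring
    have hm := norm_iteratedFDeriv_mul_le (N := ∞) (𝕜 := ℝ) (n := m)
      ((φ.smooth ⊤).comp A.contDiff) ((h.smooth ⊤).comp B.contDiff) p (mod_cast le_top)
    calc ‖p‖ ^ k * ‖iteratedFDeriv ℝ m (fun q => φ (A q) * h (B q)) p‖
        ≤ (K ^ k * 2 ^ (k - 1) * (‖A p‖ ^ k + ‖B p‖ ^ k)) *
          ∑ i ∈ Finset.range (m + 1), m.choose i * ‖iteratedFDeriv ℝ i (fun q => φ (A q)) p‖
            * ‖iteratedFDeriv ℝ (m - i) (fun q => h (B q)) p‖ := by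
          gcongr
          exact hm
      _ = K ^ k * 2 ^ (k - 1) * ∑ i ∈ Finset.range (m + 1), m.choose i *
          ((‖A p‖ ^ k * ‖iteratedFDeriv ℝ i (fun q => φ (A q)) p‖)
            * (‖B p‖ ^ 0 * ‖iteratedFDeriv ℝ (m - i) (fun q => h (B q)) p‖)
          + (‖A p‖ ^ 0 * ‖iteratedFDeriv ℝ i (fun q => φ (A q)) p‖)
            * (‖B p‖ ^ k * ‖iteratedFDeriv ℝ (m - i) (fun q => h (B q)) p‖)) := by
          rw [mul_assoc, Finset.mul_sum]
          congr 1
          exact Finset.sum_congr rfl fun i _ => by ring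
      _ ≤ _ := by
        have hA : ∀ k i, 0 ≤ ‖A‖ ^ i * SchwartzMap.seminorm ℝ k i φ := fun k i =>
          mul_nonneg (by positivity) (apply_nonneg _ _)
        refine mul_le_mul_of_nonneg_left (Finset.sum_le_sum fun i _ =>
          mul_le_mul_of_nonneg_left (add_le_add ?_ ?_) (by positivity)) (by positivity) <;>
        exact mul_le_mul (iteratedFDeriv_schwartz_comp_le A φ _ _ p)
          (iteratedFDeriv_schwartz_comp_le B h _ _ p) (by positivity) (hA _ _)

end Tensor

/-! ### Shears of the phase space and sheared products. -/

section Shear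

variable {n : ℕ}

/-- The shear `(x, v) ↦ x - σ v`. -/
def shearFst (n : ℕ) (σ : ℝ) : Phase n →L[ℝ] EuclideanSpace ℝ (Fin n) :=
  ContinuousLinearMap.fst ℝ _ _ - σ • ContinuousLinearMap.snd ℝ _ _

theorem shearFst_apply (σ : ℝ) (p : Phase n) : shearFst n σ p = p.1 - σ • p.2 := rfl

theorem norm_le_shear (σ : ℝ) (p : Phase n) :
    ‖p‖ ≤ (1 + |σ|) * (‖shearFst n σ p‖ + ‖ContinuousLinearMap.snd ℝ
      (EuclideanSpace ℝ (Fin n)) (EuclideanSpace ℝ (Fin n)) p‖) := by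
  rw [shearFst_apply, ContinuousLinearMap.coe_snd']
  have h1 : ‖p.1‖ ≤ ‖p.1 - σ • p.2‖ + |σ| * ‖p.2‖ := by
    have := norm_add_le (p.1 - σ • p.2) (σ • p.2)
    rwa [sub_add_cancel, norm_smul, Real.norm_eq_abs] at this
  have := norm_nonneg (p.1 - σ • p.2)
  have := norm_nonneg p.2
  have := abs_nonneg σ
  rw [Prod.norm_def]
  refine max_le ?_ ?_ <;> nlinarith

/-- The function `(x, v) ↦ φ(x - σ v) h(v)`. -/
def shearTensor (σ : ℝ) (φ h : 𝓢(EuclideanSpace ℝ (Fin n), ℂ)) : 𝓢(Phase n, ℂ) :=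
  tensorAlong (shearFst n σ) (ContinuousLinearMap.snd ℝ _ _) (by positivity : 0 ≤ 1 + |σ|)
    (norm_le_shear σ) φ h

theorem shearTensor_apply (σ : ℝ) (φ h : 𝓢(EuclideanSpace ℝ (Fin n), ℂ)) (p : Phase n) :
    shearTensor σ φ h p = φ (p.1 - σ • p.2) * h p.2 := rfl

theorem lineDeriv_shearTensor (σ : ℝ) (φ h : 𝓢(EuclideanSpace ℝ (Fin n), ℂ)) (m : Phase n) :
    ∂_{m} (shearTensor σ φ h)
      = shearTensor σ (∂_{m.1 - σ • m.2} φ) h + shearTensor σ φ (∂_{m.2} h) := by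
  ext p
  rw [add_apply, shearTensor_apply, shearTensor_apply,
    SchwartzMap.lineDerivOp_apply_eq_fderiv, SchwartzMap.lineDerivOp_apply_eq_fderiv,
    SchwartzMap.lineDerivOp_apply_eq_fderiv]
  have h1 : HasFDerivAt (fun q : Phase n => φ (shearFst n σ q))
      ((fderiv ℝ φ (shearFst n σ p)).comp (shearFst n σ)) p :=
    (φ.hasFDerivAt _).comp p (shearFst n σ).hasFDerivAt
  have h2 : HasFDerivAt (fun q : Phase n => h q.2)
      ((fderiv ℝ h p.2).comp (ContinuousLinearMap.snd ℝ _ _)) p :=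
    (h.hasFDerivAt _).comp p hasFDerivAt_snd
  have h3 : fderiv ℝ (shearTensor σ φ h) p = _ := (h1.mul h2).fderiv
  rw [h3]
  simp [shearFst_apply]
  ring

/-- For fixed `v` the shear is a translation in `x`, so Fubini separates the variables. -/
theorem integral_shear (σ : ℝ) (φ h : 𝓢(EuclideanSpace ℝ (Fin n), ℂ)) :
    ∫ p : Phase n, shearTensor σ φ h p = (∫ y, φ y) * ∫ v, h v := by
  have hint : Integrable (shearTensor σ φ h) (volume : Measure (Phase n)) :=
    SchwartzMap.integrable _
  rw [Measure.volume_eq_prod] at hint ⊢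
  rw [integral_prod_symm _ hint]
  simp only [shearTensor_apply]
  rw [← integral_const_mul]
  congr 1
  ext v
  rw [integral_mul_const, integral_sub_right_eq_self (fun y => φ y)]

end Shear

/-! ### The harmonic oscillator on Schwartz functions -/

/-- The `ℝ`-bilinear map `(a, b) ↦ conj a * b`. -/
def conjMul : ℂ →L[ℝ] ℂ →L[ℝ] ℂ :=
  (ContinuousLinearMap.mul ℝ ℂ).comp (Complex.conjCLE : ℂ →L[ℝ] ℂ)

theorem conjMul_apply (a b : ℂ) : conjMul a b = (starRingEnd ℂ) a * b := rfl

/-! ### Formal adjoints in `L²` for Schwartz functions. -/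

section L2Inner

variable {E : Type*} [NormedAddCommGroup E] [NormedSpace ℝ E] [FiniteDimensional ℝ E]
  [MeasurableSpace E] [BorelSpace E] (μ : Measure E)

theorem inner_toLp [μ.HasTemperateGrowth] (f g : 𝓢(E, ℂ)) :
    ⟪f.toLp 2 μ, g.toLp 2 μ⟫_ℂ = ∫ x, (starRingEnd ℂ) (f x) * g x ∂μ := by
  rw [SchwartzMap.inner_toL2_toL2_eq f g μ]
  simp [mul_comm]

theorem inner_lineDeriv_left [μ.IsAddHaarMeasure] (f g : 𝓢(E, ℂ)) (m : E) :
    ⟪(∂_{m} f).toLp 2 μ, g.toLp 2 μ⟫_ℂ = -⟪f.toLp 2 μ, (∂_{m} g).toLp 2 μ⟫_ℂ := by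
  rw [inner_toLp, inner_toLp]
  have := SchwartzMap.integral_bilinear_lineDerivOp_right_eq_neg_left (μ := μ) f g conjMul m
  simp only [conjMul_apply] at this
  rw [this, neg_neg]

theorem inner_smulLeft_left [μ.HasTemperateGrowth] {q : E → ℂ} (hq : q.HasTemperateGrowth)
    (hreal : ∀ x, (starRingEnd ℂ) (q x) = q x) (f g : 𝓢(E, ℂ)) :
    ⟪(SchwartzMap.smulLeftCLM ℂ q f).toLp 2 μ, g.toLp 2 μ⟫_ℂ
      = ⟪f.toLp 2 μ, (SchwartzMap.smulLeftCLM ℂ q g).toLp 2 μ⟫_ℂ := by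
  rw [inner_toLp, inner_toLp]
  congr 1
  ext x
  simp only [SchwartzMap.smulLeftCLM_apply_apply hq, smul_eq_mul, map_mul, hreal]
  ring

end L2Inner

section Calculus

variable {E : Type*} [NormedAddCommGroup E] [NormedSpace ℝ E]

theorem lineDeriv_lineDeriv_comm (f : 𝓢(E, ℂ)) (m k : E) : ∂_{m} (∂_{k} f) = ∂_{k} (∂_{m} f) := by
  ext x
  have e : ∀ m k : E, ∂_{m} (∂_{k} f) x = fderiv ℝ (fderiv ℝ f) x m k := fun m k => by
    rw [SchwartzMap.lineDerivOp_apply_eq_fderiv]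
    have h1 : ((∂_{k} f : 𝓢(E, ℂ)) : E → ℂ) = fun y => fderiv ℝ f y k := by
      ext y
      exact SchwartzMap.lineDerivOp_apply_eq_fderiv k f y
    have h2 : DifferentiableAt ℝ (fderiv ℝ f) x :=
      ((f.smooth 2).fderiv_right (m := 1) le_rfl).differentiable one_ne_zero x
    rw [h1, fderiv_clm_apply h2 (differentiableAt_const k)]
    simp
  rw [e, e]
  exact ((f.smooth 2).contDiffAt.isSymmSndFDerivAt (by simp)).eq m k

theorem lineDeriv_smulLeft {q : E → ℂ} (hq : q.HasTemperateGrowth) (L : E →L[ℝ] ℂ)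
    (hL : ∀ x, q x = L x) (f : 𝓢(E, ℂ)) (m : E) :
    ∂_{m} (SchwartzMap.smulLeftCLM ℂ q f)
      = SchwartzMap.smulLeftCLM ℂ q (∂_{m} f) + L m • f := by
  ext x
  rw [add_apply, smul_apply, SchwartzMap.smulLeftCLM_apply_apply hq,
    SchwartzMap.lineDerivOp_apply_eq_fderiv, SchwartzMap.lineDerivOp_apply_eq_fderiv]
  have h1 : (⇑(SchwartzMap.smulLeftCLM ℂ q f) : E → ℂ) = fun y => L y * f y := by
    ext y
    rw [SchwartzMap.smulLeftCLM_apply_apply hq, hL, smul_eq_mul]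
  have h2 : fderiv ℝ (fun y => L y * f y) x = _ := (L.hasFDerivAt.mul (f.hasFDerivAt x)).fderiv
  rw [h1, h2, hL]
  simp
  ring

end Calculus

section Oscillator

variable {n : ℕ}

/-- The coordinate `v ↦ v_j` as a complex-valued real-linear map. -/
def coordC (j : Fin n) : EuclideanSpace ℝ (Fin n) →L[ℝ] ℂ :=
  Complex.ofRealCLM ∘L EuclideanSpace.proj j

theorem coordC_apply (j : Fin n) (v : EuclideanSpace ℝ (Fin n)) : coordC j v = ((v j : ℝ) : ℂ) :=
  rfl

/-- Multiplication by `v_j` on Schwartz functions. -/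
def mulCoord (j : Fin n) :
    𝓢(EuclideanSpace ℝ (Fin n), ℂ) →ₗ[ℂ] 𝓢(EuclideanSpace ℝ (Fin n), ℂ) :=
  (SchwartzMap.smulLeftCLM ℂ (coordC j)).toLinearMap

/-- The partial derivative `∂_j` on Schwartz functions. -/
def partialD (j : Fin n) :
    𝓢(EuclideanSpace ℝ (Fin n), ℂ) →ₗ[ℂ] 𝓢(EuclideanSpace ℝ (Fin n), ℂ) :=
  (LineDeriv.lineDerivOpCLM ℂ 𝓢(EuclideanSpace ℝ (Fin n), ℂ)
    (EuclideanSpace.single j (1 : ℝ))).toLinearMap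

theorem mulCoord_apply (j : Fin n) (f : 𝓢(EuclideanSpace ℝ (Fin n), ℂ))
    (v : EuclideanSpace ℝ (Fin n)) : mulCoord j f v = ((v j : ℝ) : ℂ) * f v :=
  SchwartzMap.smulLeftCLM_apply_apply (coordC j).hasTemperateGrowth f v

theorem partialD_eq (j : Fin n) (f : 𝓢(EuclideanSpace ℝ (Fin n), ℂ)) :
    partialD j f = ∂_{EuclideanSpace.single j (1 : ℝ)} f := rfl

theorem partialD_mulCoord (j k : Fin n) (f : 𝓢(EuclideanSpace ℝ (Fin n), ℂ)) :
    partialD j (mulCoord k f) = mulCoord k (partialD j f) + if j = k then f else 0 := by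
  have := lineDeriv_smulLeft (coordC k).hasTemperateGrowth (coordC k) (fun _ => rfl) f
    (EuclideanSpace.single j (1 : ℝ))
  rw [coordC_apply] at this
  rw [partialD_eq, partialD_eq]
  refine this.trans ?_
  congr 1
  by_cases h : j = k
  · subst h; simp
  · simp [h, Ne.symm h]

theorem mulCoord_comm (j k : Fin n) (f : 𝓢(EuclideanSpace ℝ (Fin n), ℂ)) :
    mulCoord j (mulCoord k f) = mulCoord k (mulCoord j f) := by
  ext v
  simp only [mulCoord_apply]
  ring

theorem partialD_comm (j k : Fin n) (f : 𝓢(EuclideanSpace ℝ (Fin n), ℂ)) :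
    partialD j (partialD k f) = partialD k (partialD j f) :=
  lineDeriv_lineDeriv_comm f _ _

/-- The annihilation operator `∂_j + v_j / 2`. -/
def annihilate (j : Fin n) :
    𝓢(EuclideanSpace ℝ (Fin n), ℂ) →ₗ[ℂ] 𝓢(EuclideanSpace ℝ (Fin n), ℂ) :=
  partialD j + (1 / 2 : ℂ) • mulCoord j

/-- The creation operator `-∂_j + v_j / 2`. -/
def create (j : Fin n) :
    𝓢(EuclideanSpace ℝ (Fin n), ℂ) →ₗ[ℂ] 𝓢(EuclideanSpace ℝ (Fin n), ℂ) :=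
  -partialD j + (1 / 2 : ℂ) • mulCoord j

variable (n) in
/-- The inclusion of Schwartz functions into `L²`. -/
def schwartzL2 : 𝓢(EuclideanSpace ℝ (Fin n), ℂ) →ₗ[ℂ]
    Lp ℂ 2 (volume : Measure (EuclideanSpace ℝ (Fin n))) :=
  (SchwartzMap.toLpCLM ℂ ℂ 2 volume).toLinearMap

theorem schwartzL2_apply (f : 𝓢(EuclideanSpace ℝ (Fin n), ℂ)) :
    schwartzL2 n f = f.toLp 2 volume := rfl

theorem isLadder_oscillator : IsLadder (schwartzL2 n) annihilate create where
  adj j f g := by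
    have h1 : ⟪schwartzL2 n (partialD j f), schwartzL2 n g⟫_ℂ
        = -⟪schwartzL2 n f, schwartzL2 n (partialD j g)⟫_ℂ := inner_lineDeriv_left _ f g _
    have h2 : ⟪schwartzL2 n (mulCoord j f), schwartzL2 n g⟫_ℂ
        = ⟪schwartzL2 n f, schwartzL2 n (mulCoord j g)⟫_ℂ :=
      inner_smulLeft_left _ (coordC j).hasTemperateGrowth
        (fun x => by rw [coordC_apply, Complex.conj_ofReal]) f g
    simp only [annihilate, create, LinearMap.add_apply, LinearMap.neg_apply, LinearMap.smul_apply,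
      map_add, map_neg, map_smul, inner_add_left, inner_add_right, inner_neg_right,
      inner_smul_left, inner_smul_right, h1, h2]
    have hc : (starRingEnd ℂ) (1 / 2) = 1 / 2 := by norm_num [Complex.ext_iff]
    rw [hc]
  comm j k f := by
    simp only [annihilate, LinearMap.add_apply, LinearMap.smul_apply, map_add, map_smul,
      partialD_mulCoord, partialD_comm j k, mulCoord_comm j k, eq_comm (a := j) (b := k)]
    module
  comm' j k f := by
    simp only [create, LinearMap.add_apply, LinearMap.neg_apply, LinearMap.smul_apply, map_add,
      map_neg, map_smul, partialD_mulCoord, partialD_comm j k, mulCoord_comm j k,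
      eq_comm (a := j) (b := k)]
    module
  ccr j k f := by
    simp only [annihilate, create, LinearMap.add_apply, LinearMap.neg_apply, LinearMap.smul_apply,
      map_add, map_neg, map_smul, partialD_mulCoord, partialD_comm j k, mulCoord_comm j k,
      eq_comm (a := j) (b := k)]
    split_ifs <;> module

theorem numberOp_oscillator (f : 𝓢(EuclideanSpace ℝ (Fin n), ℂ)) :
    numberOp annihilate create f = -(∑ j, partialD j (partialD j f))
      + (1 / 4 : ℂ) • (∑ j, mulCoord j (mulCoord j f)) - ((n : ℂ) / 2) • f := by
  have hn : ((n : ℂ) / 2) • f = ∑ _j : Fin n, (1 / 2 : ℂ) • f := by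
    rw [Finset.sum_const, Finset.card_univ, Fintype.card_fin, ← Nat.cast_smul_eq_nsmul ℂ, smul_smul]
    congr 1
    ring
  rw [hn, numberOp_apply, Finset.smul_sum, ← Finset.sum_neg_distrib, ← Finset.sum_add_distrib,
    ← Finset.sum_sub_distrib]
  refine Finset.sum_congr rfl fun j _ => ?_
  simp only [annihilate, create, LinearMap.add_apply, LinearMap.neg_apply, LinearMap.smul_apply,
    map_add, map_smul, partialD_mulCoord, if_true]
  module

theorem partialD_gaussian (j : Fin n) :
    partialD j (gaussian (EuclideanSpace ℝ (Fin n)))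
      = -(1 / 2 : ℂ) • mulCoord j (gaussian (EuclideanSpace ℝ (Fin n))) := by
  ext v
  rw [smul_apply, mulCoord_apply, partialD_eq, SchwartzMap.lineDerivOp_apply_eq_fderiv,
    gaussian_apply]
  have h1 : HasFDerivAt (fun v : EuclideanSpace ℝ (Fin n) => -(‖v‖ ^ 2 / 4))
      (-((4 : ℝ)⁻¹ • (2 • innerSL ℝ v))) v := by
    have := ((hasStrictFDerivAt_norm_sq v).hasFDerivAt.mul_const ((4 : ℝ)⁻¹)).neg
    have e : (fun v : EuclideanSpace ℝ (Fin n) => -(‖v‖ ^ 2 / 4))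
        = -fun y : EuclideanSpace ℝ (Fin n) => ‖y‖ ^ 2 * (4 : ℝ)⁻¹ := by
      ext y
      simp [div_eq_mul_inv]
    rw [e]
    exact this
  have h3 := Complex.ofRealCLM.hasFDerivAt.comp v h1.exp
  have h4 : fderiv ℝ (gaussian (EuclideanSpace ℝ (Fin n))) v = _ := h3.fderiv
  rw [h4]
  simp [EuclideanSpace.inner_single_right, innerSL_apply_apply]
  ring

theorem annihilate_gaussian (j : Fin n) :
    annihilate j (gaussian (EuclideanSpace ℝ (Fin n))) = 0 := by
  simp only [annihilate, LinearMap.add_apply, LinearMap.smul_apply, partialD_gaussian]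
  module

theorem gaussian_mem_levelSpace :
    gaussian (EuclideanSpace ℝ (Fin n)) ∈ levelSpace (n := n) annihilate create 0 := by
  rw [mem_levelSpace, numberOp_apply]
  simp [annihilate_gaussian]

theorem mulCoord_eq (j : Fin n) (f : 𝓢(EuclideanSpace ℝ (Fin n), ℂ)) :
    mulCoord j f = annihilate j f + create j f := by
  simp only [annihilate, create, LinearMap.add_apply, LinearMap.neg_apply, LinearMap.smul_apply]
  module

theorem schwartzL2_injective : Function.Injective (schwartzL2 n) :=
  SchwartzMap.injective_toLp 2 volume

theorem annihilate_eq_zero {f : 𝓢(EuclideanSpace ℝ (Fin n), ℂ)}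
    (hf : f ∈ levelSpace (n := n) annihilate create 0) (j : Fin n) : annihilate j f = 0 :=
  schwartzL2_injective <| by
    rw [isLadder_oscillator.map_annihilate_eq_zero hf j, map_zero]

/-- Since `v_j = a_j + a'_j`, multiplication moves one level up and one down; at level zero the
downward part vanishes. This places every monomial times the Gaussian among the Hermite functions.
-/
theorem mulCoord_mem_iSup_levelSpace {f : 𝓢(EuclideanSpace ℝ (Fin n), ℂ)}
    (hf : f ∈ ⨆ k, levelSpace (n := n) annihilate create k) (j : Fin n) :
    mulCoord j f ∈ ⨆ k, levelSpace (n := n) annihilate create k := by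
  induction hf using Submodule.iSup_induction' with
  | mem k f hf =>
    rw [mulCoord_eq]
    refine Submodule.add_mem _ ?_ (Submodule.mem_iSup_of_mem _
      (isLadder_oscillator.create_mem_levelSpace hf j))
    rcases k with _ | k
    · rw [annihilate_eq_zero hf]
      exact Submodule.zero_mem _
    · exact Submodule.mem_iSup_of_mem _ (isLadder_oscillator.annihilate_mem_levelSpace hf j)
  | zero => rw [map_zero]; exact Submodule.zero_mem _
  | add f g _ _ hf hg => rw [map_add]; exact Submodule.add_mem _ hf hg

end Oscillator

/-! ### The operator on Schwartz functions of the phase space -/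

section Operator

variable {n : ℕ}

variable (n) in
/-- The operator `σ v·∇ₓ - Δ_v + |v|²/4 - n/2` on Schwartz functions. -/
def kfpSchwartz (σ : ℝ) : 𝓢(Phase n, ℂ) →ₗ[ℂ] 𝓢(Phase n, ℂ) :=
  ((σ : ℂ) • (∑ j : Fin n, SchwartzMap.smulLeftCLM ℂ (vCoord j) ∘L
      LineDeriv.lineDerivOpCLM ℂ 𝓢(Phase n, ℂ) (ex j))
    - (∑ j : Fin n, LineDeriv.lineDerivOpCLM ℂ 𝓢(Phase n, ℂ) (ev j) ∘L
        LineDeriv.lineDerivOpCLM ℂ 𝓢(Phase n, ℂ) (ev j))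
    + (1 / 4 : ℂ) • SchwartzMap.smulLeftCLM ℂ vNormSq
    - ((n : ℂ) / 2) • ContinuousLinearMap.id ℂ 𝓢(Phase n, ℂ)).toLinearMap

theorem kfpSchwartz_apply (σ : ℝ) (f : 𝓢(Phase n, ℂ)) :
    kfpSchwartz n σ f = (σ : ℂ) • (∑ j, SchwartzMap.smulLeftCLM ℂ (vCoord j) (∂_{ex j} f))
      - (∑ j : Fin n, ∂_{ev j} (∂_{ev j} f)) + (1 / 4 : ℂ) • SchwartzMap.smulLeftCLM ℂ vNormSq f
      - ((n : ℂ) / 2) • f := by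
  simp [kfpSchwartz]

theorem freeKFPDistrib_eq (T : 𝓢'(Phase n, ℂ)) :
    freeKFPDistrib n T
      = (∑ j : Fin n, TemperedDistribution.smulLeftCLM ℂ (vCoord j) (∂_{ex j} T))
      - (∑ j : Fin n, ∂_{ev j} (∂_{ev j} T))
      + (1 / 4 : ℂ) • TemperedDistribution.smulLeftCLM ℂ vNormSq T
      - ((n : ℂ) / 2) • T := by
  simp [freeKFPDistrib]

/-- The transpose of the free Kramers-Fokker-Planck operator is obtained by `σ = -1`. -/
theorem freeKFPDistrib_apply (T : 𝓢'(Phase n, ℂ)) (φ : 𝓢(Phase n, ℂ)) :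
    freeKFPDistrib n T φ = T (kfpSchwartz n (-1) φ) := by
  -- `∂_{x_j}` commutes with `v_j`, so transposition only flips the sign of the transport term.
  have h1 : ∀ j : Fin n, ∂_{ex j} (SchwartzMap.smulLeftCLM ℂ (vCoord j) φ)
      = SchwartzMap.smulLeftCLM ℂ (vCoord j) (∂_{ex j} φ) := fun j => by
    have := lineDeriv_smulLeft (hasTemperateGrowth_vCoord j)
      (coordC j ∘L ContinuousLinearMap.snd ℝ (EuclideanSpace ℝ (Fin n))
        (EuclideanSpace ℝ (Fin n))) (fun _ => rfl) φ (ex j)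
    rw [this]
    simp [ex]
  rw [freeKFPDistrib_eq, kfpSchwartz_apply]
  simp [map_sum, h1, LineDeriv.lineDerivOp_neg]

theorem smulLeft_toTemperedDistribution {q : Phase n → ℂ} (hq : q.HasTemperateGrowth)
    (f : 𝓢(Phase n, ℂ)) :
    TemperedDistribution.smulLeftCLM ℂ q
        (SchwartzMap.toTemperedDistributionCLM (Phase n) ℂ volume f)
      = SchwartzMap.toTemperedDistributionCLM (Phase n) ℂ volume
        (SchwartzMap.smulLeftCLM ℂ q f) := by
  ext φ
  simp only [TemperedDistribution.smulLeftCLM_apply_apply,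
    SchwartzMap.toTemperedDistributionCLM_apply_apply, SchwartzMap.smulLeftCLM_apply_apply hq,
    smul_eq_mul]
  congr 1
  ext x
  ring

variable (n) in
/-- The inclusion of Schwartz functions on the phase space into `L²`. -/
def phaseL2 : 𝓢(Phase n, ℂ) →ₗ[ℂ] L2 n :=
  (SchwartzMap.toLpCLM ℂ ℂ 2 (volume : Measure (Phase n))).toLinearMap

theorem toDistrib_phaseL2 (f : 𝓢(Phase n, ℂ)) :
    L2.toDistrib n (phaseL2 n f) = SchwartzMap.toTemperedDistributionCLM (Phase n) ℂ volume f :=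
  Lp.toTemperedDistribution_toLp_eq f

theorem toDistrib_apply (u : L2 n) (φ : 𝓢(Phase n, ℂ)) :
    L2.toDistrib n u φ = ∫ p, φ p * u p :=
  Lp.toTemperedDistribution_apply u φ

theorem freeKFPDistrib_phaseL2 (f : 𝓢(Phase n, ℂ)) :
    freeKFPDistrib n (L2.toDistrib n (phaseL2 n f))
      = L2.toDistrib n (phaseL2 n (kfpSchwartz n 1 f)) := by
  rw [toDistrib_phaseL2, toDistrib_phaseL2, freeKFPDistrib_eq, kfpSchwartz_apply]
  simp only [TemperedDistribution.lineDerivOp_toTemperedDistributionCLM_eq,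
    smulLeft_toTemperedDistribution (hasTemperateGrowth_vCoord _),
    smulLeft_toTemperedDistribution hasTemperateGrowth_vNormSq, map_sub, map_add, map_sum,
    map_smul, Complex.ofReal_one, one_smul]

/-- The product `φ(x - σ v) h(v)` as a bilinear map. -/
def shearTensorL (σ : ℝ) : 𝓢(EuclideanSpace ℝ (Fin n), ℂ) →ₗ[ℂ]
    𝓢(EuclideanSpace ℝ (Fin n), ℂ) →ₗ[ℂ] 𝓢(Phase n, ℂ) :=
  LinearMap.mk₂ ℂ (shearTensor σ)
    (fun _ _ _ => by ext p; simp [shearTensor_apply, add_mul])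
    (fun _ _ _ => by ext p; simp [shearTensor_apply, mul_assoc])
    (fun _ _ _ => by ext p; simp [shearTensor_apply, mul_add])
    (fun _ _ _ => by ext p; simp [shearTensor_apply, mul_left_comm])

theorem shearTensorL_apply (σ : ℝ) (φ h : 𝓢(EuclideanSpace ℝ (Fin n), ℂ)) (p : Phase n) :
    shearTensorL σ φ h p = φ (p.1 - σ • p.2) * h p.2 := rfl

theorem lineDeriv_ex_shearTensorL (σ : ℝ) (φ h : 𝓢(EuclideanSpace ℝ (Fin n), ℂ)) (j : Fin n) :
    ∂_{ex j} (shearTensorL σ φ h) = shearTensorL σ (partialD j φ) h := by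
  refine (lineDeriv_shearTensor σ φ h (ex j)).trans ?_
  ext p
  simp [ex, shearTensor_apply, shearTensorL_apply, partialD_eq, LineDeriv.lineDerivOp_left_zero]

theorem lineDeriv_ev_shearTensorL (σ : ℝ) (φ h : 𝓢(EuclideanSpace ℝ (Fin n), ℂ)) (j : Fin n) :
    ∂_{ev j} (shearTensorL σ φ h)
      = -(σ : ℂ) • shearTensorL σ (partialD j φ) h + shearTensorL σ φ (partialD j h) := by
  refine (lineDeriv_shearTensor σ φ h (ev j)).trans ?_
  ext p
  simp [ev, shearTensor_apply, shearTensorL_apply, partialD_eq, LineDeriv.lineDerivOp_left_neg,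
    LineDeriv.lineDerivOp_left_smul]
  ring

theorem smulLeft_vCoord_shearTensorL (σ : ℝ) (φ h : 𝓢(EuclideanSpace ℝ (Fin n), ℂ))
    (j : Fin n) : SchwartzMap.smulLeftCLM ℂ (vCoord j) (shearTensorL σ φ h)
      = shearTensorL σ φ (mulCoord j h) := by
  ext p
  rw [SchwartzMap.smulLeftCLM_apply_apply (hasTemperateGrowth_vCoord j)]
  simp only [shearTensorL_apply, mulCoord_apply, vCoord, smul_eq_mul]
  ring

theorem smulLeft_vNormSq_shearTensorL (σ : ℝ) (φ h : 𝓢(EuclideanSpace ℝ (Fin n), ℂ)) :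
    SchwartzMap.smulLeftCLM ℂ vNormSq (shearTensorL σ φ h)
      = shearTensorL σ φ (∑ j, mulCoord j (mulCoord j h)) := by
  ext p
  rw [SchwartzMap.smulLeftCLM_apply_apply hasTemperateGrowth_vNormSq]
  simp only [shearTensorL_apply, sum_apply, mulCoord_apply, vNormSq, smul_eq_mul,
    EuclideanSpace.norm_sq_eq, Complex.ofReal_sum, Finset.sum_mul, Finset.mul_sum]
  refine Finset.sum_congr rfl fun j _ => ?_
  simp
  ring

/-- The action of the operator on sheared products. -/
theorem kfpSchwartz_shearTensorL {σ : ℝ} (hσ : σ ^ 2 = 1)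
    (φ h : 𝓢(EuclideanSpace ℝ (Fin n), ℂ)) :
    kfpSchwartz n σ (shearTensorL σ φ h)
      = shearTensorL σ φ (numberOp annihilate create h)
        - shearTensorL σ (∑ j, partialD j (partialD j φ)) h
        + (2 * σ : ℂ) • ∑ j, shearTensorL σ (partialD j φ) (annihilate j h) := by
  have hσ' : (σ : ℂ) ^ 2 = 1 := by exact_mod_cast hσ
  rw [kfpSchwartz_apply, numberOp_oscillator, smulLeft_vNormSq_shearTensorL]
  -- `σ² = 1` keeps `Δφ` with coefficient one. In `-Δ_v` the cross term becomes `2σ ∇φ·∇h`, which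
  -- joins `σ v·∇φ h` to form `2σ ∇φ·(a h)`.
  have h2 : ∀ j, ∂_{ev j} (∂_{ev j} (shearTensorL σ φ h))
      = shearTensorL σ (partialD j (partialD j φ)) h
        - (2 * σ : ℂ) • shearTensorL σ (partialD j φ) (partialD j h)
        + shearTensorL σ φ (partialD j (partialD j h)) := fun j => by
    rw [lineDeriv_ev_shearTensorL, LineDeriv.lineDerivOp_add, LineDeriv.lineDerivOp_smul,
      lineDeriv_ev_shearTensorL, lineDeriv_ev_shearTensorL, smul_add, smul_smul, neg_mul_neg,
      ← sq, hσ']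
    module
  simp only [h2, lineDeriv_ex_shearTensorL, smulLeft_vCoord_shearTensorL, map_sum, map_add,
    map_sub, map_neg, map_smul, LinearMap.sum_apply, annihilate, LinearMap.add_apply,
    LinearMap.smul_apply, Finset.sum_add_distrib, Finset.sum_sub_distrib, ← Finset.smul_sum,
    smul_add]
  module

end Operator

/-! ### Plancherel in the sheared position variable. -/

section FourierPlancherel

variable {n : ℕ}

theorem fourier_partialD (j : Fin n) (φ : 𝓢(EuclideanSpace ℝ (Fin n), ℂ))
    (η : EuclideanSpace ℝ (Fin n)) :
    𝓕 (partialD j φ) η = (2 * Real.pi * Complex.I * (η j : ℝ)) * 𝓕 φ η := by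
  have hg : (inner ℝ · (EuclideanSpace.single j (1 : ℝ)) :
      EuclideanSpace ℝ (Fin n) → ℝ).HasTemperateGrowth := by fun_prop
  rw [partialD_eq, SchwartzMap.fourier_lineDerivOp_eq, smul_apply,
    SchwartzMap.smulLeftCLM_apply_apply hg]
  simp [EuclideanSpace.inner_single_right]
  ring

theorem fourier_laplacian (φ : 𝓢(EuclideanSpace ℝ (Fin n), ℂ)) (η : EuclideanSpace ℝ (Fin n)) :
    𝓕 (∑ j, partialD j (partialD j φ)) η = -((‖(2 * Real.pi) • η‖ ^ 2 : ℝ) : ℂ) * 𝓕 φ η := by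
  have : 𝓕 (∑ j, partialD j (partialD j φ)) = ∑ j, 𝓕 (partialD j (partialD j φ)) :=
    map_sum (SchwartzMap.fourierTransformCLM ℂ) _ _
  rw [this, sum_apply, EuclideanSpace.norm_sq_eq, Complex.ofReal_sum, ← Finset.sum_neg_distrib,
    Finset.sum_mul]
  refine Finset.sum_congr rfl fun j _ => ?_
  rw [fourier_partialD, fourier_partialD]
  simp only [PiLp.smul_apply, smul_eq_mul, norm_mul, mul_pow, Real.norm_eq_abs, sq_abs]
  push_cast
  linear_combination (4 * (Real.pi : ℂ) ^ 2 * ((η j : ℝ) : ℂ) ^ 2 * 𝓕 φ η) * Complex.I_sq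

/-- The integrand is again a sheared product, so `integral_shear` factorises the inner product. -/
theorem inner_shearTensorL (σ : ℝ) (φ h ψ k : 𝓢(EuclideanSpace ℝ (Fin n), ℂ)) :
    ⟪phaseL2 n (shearTensorL σ φ h), phaseL2 n (shearTensorL σ ψ k)⟫_ℂ
      = ⟪schwartzL2 n φ, schwartzL2 n ψ⟫_ℂ * ⟪schwartzL2 n h, schwartzL2 n k⟫_ℂ := by
  have e1 := inner_toLp (volume : Measure (Phase n)) (shearTensorL σ φ h) (shearTensorL σ ψ k)
  have e2 := inner_toLp (volume : Measure (EuclideanSpace ℝ (Fin n))) φ ψ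
  have e3 := inner_toLp (volume : Measure (EuclideanSpace ℝ (Fin n))) h k
  have e4 := integral_shear σ (SchwartzMap.pairing conjMul φ ψ) (SchwartzMap.pairing conjMul h k)
  simp only [shearTensor_apply, SchwartzMap.pairing_apply_apply, conjMul_apply] at e4
  refine e1.trans (Eq.trans ?_ (e4.trans (congrArg₂ _ e2.symm e3.symm)))
  congr 1
  ext p
  simp only [shearTensorL_apply, map_mul]
  ring

theorem inner_fourier (φ ψ : 𝓢(EuclideanSpace ℝ (Fin n), ℂ)) :
    ⟪schwartzL2 n φ, schwartzL2 n ψ⟫_ℂ = ∫ η, (starRingEnd ℂ) (𝓕 φ η) * 𝓕 ψ η := by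
  rw [← inner_toLp]
  exact (SchwartzMap.inner_fourier_toL2_eq φ ψ).symm

/-- Plancherel's theorem in the position variable for finite sums of sheared products. -/
theorem norm_sum_shearTensorL_sq {ι : Type*} [Fintype ι] (σ : ℝ)
    (φ h : ι → 𝓢(EuclideanSpace ℝ (Fin n), ℂ)) :
    Integrable (fun η => ‖schwartzL2 n (∑ i, 𝓕 (φ i) η • h i)‖ ^ 2) ∧
    ‖phaseL2 n (∑ i, shearTensorL σ (φ i) (h i))‖ ^ 2
      = ∫ η, ‖schwartzL2 n (∑ i, 𝓕 (φ i) η • h i)‖ ^ 2 := by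
  have hpt : ∀ η, ((‖schwartzL2 n (∑ i, 𝓕 (φ i) η • h i)‖ ^ 2 : ℝ) : ℂ)
      = ∑ i, ∑ j, ((starRingEnd ℂ) (𝓕 (φ i) η) * 𝓕 (φ j) η)
        * ⟪schwartzL2 n (h i), schwartzL2 n (h j)⟫_ℂ := fun η => by
    rw [← inner_self_eq_ofReal, map_sum, sum_inner]
    refine Finset.sum_congr rfl fun i _ => ?_
    rw [inner_sum]
    refine Finset.sum_congr rfl fun j _ => ?_
    rw [map_smul, map_smul, inner_smul_left, inner_smul_right, mul_assoc]
  have hint : ∀ i j, Integrable (fun η => ((starRingEnd ℂ) (𝓕 (φ i) η) * 𝓕 (φ j) η)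
        * ⟪schwartzL2 n (h i), schwartzL2 n (h j)⟫_ℂ) := fun i j =>
    (SchwartzMap.integrable (SchwartzMap.pairing conjMul (𝓕 (φ i)) (𝓕 (φ j)))).mul_const _
  have hintC : Integrable (fun η => ((‖schwartzL2 n (∑ i, 𝓕 (φ i) η • h i)‖ ^ 2 : ℝ) : ℂ)) := by
    simp only [hpt]
    exact integrable_finsetSum _ fun i _ => integrable_finsetSum _ fun j _ => hint i j
  refine ⟨hintC.re, ?_⟩
  have : ((‖phaseL2 n (∑ i, shearTensorL σ (φ i) (h i))‖ ^ 2 : ℝ) : ℂ)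
      = ((∫ η, ‖schwartzL2 n (∑ i, 𝓕 (φ i) η • h i)‖ ^ 2 : ℝ) : ℂ) := by
    rw [← inner_self_eq_ofReal, ← integral_complex_ofReal]
    simp only [hpt]
    rw [integral_finsetSum _ fun i _ => integrable_finsetSum _ fun j _ => hint i j, map_sum,
      sum_inner]
    refine Finset.sum_congr rfl fun i _ => ?_
    rw [integral_finsetSum _ fun j _ => hint i j, inner_sum]
    refine Finset.sum_congr rfl fun j _ => ?_
    rw [inner_shearTensorL, inner_fourier, integral_mul_const]
  exact_mod_cast this

end FourierPlancherel

/-! ### The core of sheared products and the resolvent estimate -/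

section Multiplier

/-- Derivatives of `g` are bounded on the compact set, so the growth condition holds with exponent
zero. -/
theorem hasTemperateGrowth_comp_of_isCompact {E F : Type*} [NormedAddCommGroup E]
    [NormedSpace ℝ E] [NormedAddCommGroup F] [NormedSpace ℝ F] {g : ℝ → F} {f : E → ℝ} {t : Set ℝ}
    (htc : IsCompact t) (ht : Set.range f ⊆ t) (htu : UniqueDiffOn ℝ t)
    (hg : ContDiffOn ℝ ∞ g t) (hf : f.HasTemperateGrowth) : (g ∘ f).HasTemperateGrowth := by
  refine Function.HasTemperateGrowth.comp' ht htu hg (fun N => ?_) hf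
  have hb : ∀ m : ℕ, ∃ C : ℝ, ∀ x ∈ t, ‖iteratedFDerivWithin ℝ m g t x‖ ≤ C := fun m =>
    htc.exists_bound_of_continuousOn (hg.continuousOn_iteratedFDerivWithin (mod_cast le_top) htu)
  choose C hC using hb
  refine ⟨0, ∑ m ∈ Finset.range (N + 1), |C m|, by positivity, fun m hm x hx => ?_⟩
  rw [pow_zero, mul_one]
  exact (hC m x hx).trans ((le_abs_self _).trans (Finset.single_le_sum
    (f := fun m => |C m|) (fun _ _ => abs_nonneg _) (Finset.mem_range.2 (by omega))))

/-- The function `η ↦ (|η|² + c)⁻¹` has temperate growth for `c` off the half-line `(-∞, 0]`. -/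
theorem hasTemperateGrowth_inv_norm_sq_add {E : Type*} [NormedAddCommGroup E]
    [InnerProductSpace ℝ E] {c : ℂ} (hc : ∀ t : ℝ, 0 ≤ t → (t : ℂ) + c ≠ 0) :
    (fun η : E => (((‖η‖ ^ 2 : ℝ) : ℂ) + c)⁻¹).HasTemperateGrowth := by
  -- With `r = (1 + |η|²)⁻¹ ∈ [0, 1]` the multiplier is `r / (1 + (c - 1) r)`; a zero of the
  -- denominator would force `(r⁻¹ - 1) + c = 0`.
  have hden : ∀ r ∈ Set.Icc (0 : ℝ) 1, (1 : ℂ) + (c - 1) * (r : ℂ) ≠ 0 := by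
    intro r hr h0
    rcases hr.1.eq_or_lt with rfl | hr0
    · simp at h0
    · refine hc (r⁻¹ - 1) (by linarith [(one_le_inv₀ hr0).2 hr.2]) ?_
      have hrC : (r : ℂ) ≠ 0 := by exact_mod_cast hr0.ne'
      push_cast
      field_simp
      linear_combination h0
  have hG : ContDiffOn ℝ ∞ (fun r : ℝ => (r : ℂ) * ((1 : ℂ) + (c - 1) * (r : ℂ))⁻¹)
      (Set.Icc 0 1) := by
    have h1 : ContDiff ℝ ∞ (fun r : ℝ => (r : ℂ)) := Complex.ofRealCLM.contDiff
    exact h1.contDiffOn.mul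
      (((contDiff_const.add (contDiff_const.mul h1)).contDiffOn).inv hden)
  have key := hasTemperateGrowth_comp_of_isCompact isCompact_Icc (t := Set.Icc (0 : ℝ) 1)
    (f := fun η : E => (1 + ‖η‖ ^ 2) ^ (-1 : ℝ)) ?_ (uniqueDiffOn_Icc zero_lt_one) hG (by fun_prop)
  · convert key using 1
    ext η
    have hw : (1 : ℂ) + ((‖η‖ ^ 2 : ℝ) : ℂ) ≠ 0 := by
      rw [← Complex.ofReal_one, ← Complex.ofReal_add]
      exact_mod_cast (by positivity : (1 : ℝ) + ‖η‖ ^ 2 ≠ 0)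
    simp only [Function.comp_apply, Real.rpow_neg_one, Complex.ofReal_inv, Complex.ofReal_add,
      Complex.ofReal_one]
    rw [← mul_inv]
    congr 1
    field_simp
    ring
  · rintro _ ⟨η, rfl⟩
    simp only [Real.rpow_neg_one]
    exact ⟨by positivity, inv_le_one_of_one_le₀ (by nlinarith [sq_nonneg ‖η‖])⟩

end Multiplier

/-! ### Helmholtz equations, the core and its resolvent estimate. -/

section Core

variable {n : ℕ}

/-- Division by the symbol `|2πη|² + c` on the Fourier side preserves Schwartz functions. -/
theorem exists_helmholtz_solution {c : ℂ} (hc : ∀ t : ℝ, 0 ≤ t → (t : ℂ) + c ≠ 0)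
    (φ : 𝓢(EuclideanSpace ℝ (Fin n), ℂ)) :
    ∃ ψ : 𝓢(EuclideanSpace ℝ (Fin n), ℂ), c • ψ - ∑ j, partialD j (partialD j ψ) = φ := by
  set q : EuclideanSpace ℝ (Fin n) → ℂ := fun η => (((‖(2 * Real.pi) • η‖ ^ 2 : ℝ) : ℂ) + c)⁻¹
  have hq : q.HasTemperateGrowth :=
    (hasTemperateGrowth_inv_norm_sq_add (E := EuclideanSpace ℝ (Fin n)) hc).comp
      ((2 * Real.pi) • ContinuousLinearMap.id ℝ (EuclideanSpace ℝ (Fin n))).hasTemperateGrowth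
  refine ⟨𝓕⁻ (SchwartzMap.smulLeftCLM ℂ q (𝓕 φ)), ?_⟩
  set ψ := 𝓕⁻ (SchwartzMap.smulLeftCLM ℂ q (𝓕 φ))
  have hψ : 𝓕 ψ = SchwartzMap.smulLeftCLM ℂ q (𝓕 φ) := FourierTransform.fourier_fourierInv_eq _
  have hF : 𝓕 (c • ψ - ∑ j, partialD j (partialD j ψ))
      = c • 𝓕 ψ - 𝓕 (∑ j, partialD j (partialD j ψ)) := by
    have := map_sub (SchwartzMap.fourierTransformCLM ℂ) (c • ψ) (∑ j, partialD j (partialD j ψ))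
    rw [map_smul] at this
    exact this
  have : 𝓕 (c • ψ - ∑ j, partialD j (partialD j ψ)) = 𝓕 φ := by
    ext η
    rw [hF, sub_apply, smul_apply, fourier_laplacian, hψ, SchwartzMap.smulLeftCLM_apply_apply hq]
    have h0 := hc (‖(2 * Real.pi) • η‖ ^ 2) (by positivity)
    simp only [q, smul_eq_mul]
    field_simp
    ring
  simpa using congrArg
    (FourierTransformInv.fourierInv : 𝓢(EuclideanSpace ℝ (Fin n), ℂ) → 𝓢(_, ℂ)) this

/-- The span of the sheared products `φ(x - σ v) h(v)` with `h` a Hermite function. -/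
def coreSpace (n : ℕ) (σ : ℝ) : Submodule ℂ 𝓢(Phase n, ℂ) :=
  Submodule.span ℂ {u | ∃ (k : ℕ) (φ h : 𝓢(EuclideanSpace ℝ (Fin n), ℂ)),
    h ∈ levelSpace (n := n) annihilate create k ∧ u = shearTensorL σ φ h}

theorem shearTensorL_mem_coreSpace (σ : ℝ) {k : ℕ} (φ : 𝓢(EuclideanSpace ℝ (Fin n), ℂ))
    {h : 𝓢(EuclideanSpace ℝ (Fin n), ℂ)} (hh : h ∈ levelSpace (n := n) annihilate create k) :
    shearTensorL σ φ h ∈ coreSpace n σ :=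
  Submodule.subset_span ⟨k, φ, h, hh, rfl⟩

theorem exists_eq_sum_of_mem_coreSpace {σ : ℝ} {u : 𝓢(Phase n, ℂ)} (hu : u ∈ coreSpace n σ) :
    ∃ (m : ℕ) (k : Fin m → ℕ) (φ h : Fin m → 𝓢(EuclideanSpace ℝ (Fin n), ℂ)),
      (∀ i, h i ∈ levelSpace (n := n) annihilate create (k i)) ∧
      u = ∑ i, shearTensorL σ (φ i) (h i) := by
  obtain ⟨m, c, g, rfl⟩ := (Submodule.mem_span_set').1 hu
  choose k φ h hh hg using fun i => (g i).2
  refine ⟨m, k, fun i => c i • φ i, h, hh, Finset.sum_congr rfl fun i _ => ?_⟩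
  rw [hg, map_smul, LinearMap.smul_apply]

theorem kfpSchwartz_sub_shearTensorL {σ : ℝ} (hσ : σ ^ 2 = 1) (z : ℂ) {k : ℕ}
    (φ : 𝓢(EuclideanSpace ℝ (Fin n), ℂ)) {h : 𝓢(EuclideanSpace ℝ (Fin n), ℂ)}
    (hh : h ∈ levelSpace (n := n) annihilate create k) :
    kfpSchwartz n σ (shearTensorL σ φ h) - z • shearTensorL σ φ h
      = shearTensorL σ (((k : ℂ) - z) • φ - ∑ j, partialD j (partialD j φ)) h
        + ∑ j, shearTensorL σ ((2 * σ : ℂ) • partialD j φ) (annihilate j h) := by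
  rw [kfpSchwartz_shearTensorL hσ, mem_levelSpace.1 hh]
  simp only [map_smul, map_sub, LinearMap.sub_apply, LinearMap.smul_apply, Finset.smul_sum]
  module

/-- The operator minus `z` maps the core onto a space containing the core. -/
theorem exists_preimage_of_mem_coreSpace {σ : ℝ} (hσ : σ ^ 2 = 1) {z : ℂ}
    (hz : ¬ (0 ≤ z.re ∧ z.im = 0)) {f : 𝓢(Phase n, ℂ)} (hf : f ∈ coreSpace n σ) :
    ∃ u ∈ coreSpace n σ, kfpSchwartz n σ u - z • u = f := by
  obtain ⟨δ, hδ, hdist⟩ := exists_dist_halfLine_pos hz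
  have hgen : ∀ (k : ℕ) (h : 𝓢(EuclideanSpace ℝ (Fin n), ℂ)),
      h ∈ levelSpace (n := n) annihilate create k → ∀ φ,
      shearTensorL σ φ h ∈ (coreSpace n σ).map (kfpSchwartz n σ - z • LinearMap.id) := by
    -- Triangular solve: a Helmholtz equation inverts the diagonal at level `k`, and the remainder
    -- lies one level lower, or is zero when `k = 0`.
    intro k
    induction k with
    | zero =>
      intro h hh φ
      obtain ⟨ψ, hψ⟩ := exists_helmholtz_solution (n := n) (c := ((0 : ℕ) : ℂ) - z)
        (fun t ht h0 => by
          have := hdist t ht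
          rw [Nat.cast_zero, zero_sub, ← sub_eq_add_neg] at h0
          rw [h0, norm_zero] at this
          linarith) φ
      refine ⟨shearTensorL σ ψ h, shearTensorL_mem_coreSpace σ ψ hh, ?_⟩
      have := kfpSchwartz_sub_shearTensorL hσ z ψ hh
      rw [hψ] at this
      refine Eq.trans ?_ (this.trans ?_)
      · simp
      · simp [annihilate_eq_zero hh]
    | succ k ih =>
      intro h hh φ
      obtain ⟨ψ, hψ⟩ := exists_helmholtz_solution (n := n) (c := ((k + 1 : ℕ) : ℂ) - z)
        (fun t ht h0 => by
          have := hdist (t + (k + 1 : ℕ)) (by positivity)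
          rw [Complex.ofReal_add, Complex.ofReal_natCast, add_sub_assoc, h0, norm_zero] at this
          linarith) φ
      have := kfpSchwartz_sub_shearTensorL hσ z ψ hh
      rw [hψ] at this
      rw [eq_sub_of_add_eq this.symm]
      refine Submodule.sub_mem _ ⟨shearTensorL σ ψ h, shearTensorL_mem_coreSpace σ ψ hh, ?_⟩
        (Submodule.sum_mem _ fun j _ => ih _
          (isLadder_oscillator.annihilate_mem_levelSpace hh j) _)
      simp
  have hle : coreSpace n σ ≤ (coreSpace n σ).map (kfpSchwartz n σ - z • LinearMap.id) := by
    refine Submodule.span_le.2 ?_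
    rintro _ ⟨k, φ, h, hh, rfl⟩
    exact hgen k h hh φ
  obtain ⟨u, hu, rfl⟩ := hle hf
  exact ⟨u, hu, by simp⟩

/-- The resolvent estimate on the core. -/
theorem norm_le_of_mem_coreSpace {z : ℂ} (hz : ¬ (0 ≤ z.re ∧ z.im = 0)) :
    ∃ C > 0, ∀ u ∈ coreSpace n 1,
      ‖phaseL2 n u‖ ^ 2 ≤ C * ‖phaseL2 n (kfpSchwartz n 1 u - z • u)‖ ^ 2 := by
  obtain ⟨C, hC, hb⟩ := (isLadder_oscillator (n := n)).lower_bound hz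
  refine ⟨C, hC, fun u hu => ?_⟩
  obtain ⟨m, k, φ, h, hh, rfl⟩ := exists_eq_sum_of_mem_coreSpace hu
  -- The image is again a finite sum of sheared products: `none` carries the diagonal term, `some j`
  -- the term with `2 ∂_j φ` and `a_j h`.
  set φ' : Fin m × Option (Fin n) → 𝓢(EuclideanSpace ℝ (Fin n), ℂ) := fun p =>
    p.2.elim ((((k p.1 : ℕ) : ℂ) - z) • φ p.1 - ∑ j, partialD j (partialD j (φ p.1)))
      (fun j => (2 * (1 : ℝ) : ℂ) • partialD j (φ p.1)) with hφ'
  set h' : Fin m × Option (Fin n) → 𝓢(EuclideanSpace ℝ (Fin n), ℂ) := fun p =>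
    p.2.elim (h p.1) (fun j => annihilate j (h p.1)) with hh'
  have hP : kfpSchwartz n 1 (∑ i, shearTensorL 1 (φ i) (h i))
      - z • ∑ i, shearTensorL 1 (φ i) (h i) = ∑ p, shearTensorL 1 (φ' p) (h' p) := by
    rw [map_sum, Finset.smul_sum, ← Finset.sum_sub_distrib, Fintype.sum_prod_type]
    refine Finset.sum_congr rfl fun i _ => ?_
    rw [kfpSchwartz_sub_shearTensorL (one_pow 2) z (φ i) (hh i), Fintype.sum_option]
    rfl
  -- The Fourier kernel is `e^{-2πi⟨x, η⟩}`, hence the frequency `ξ = 2πη`.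
  have hfib : ∀ η, ∑ p, 𝓕 (φ' p) η • h' p
      = fibreOp annihilate create ((2 * Real.pi) • η) (∑ i, 𝓕 (φ i) η • h i)
        - z • ∑ i, 𝓕 (φ i) η • h i := fun η => by
    rw [map_sum, Finset.smul_sum, ← Finset.sum_sub_distrib, Fintype.sum_prod_type]
    refine Finset.sum_congr rfl fun i _ => ?_
    have e0 : 𝓕 (φ' (i, none)) η
        = (((k i : ℕ) : ℂ) - z + ((‖(2 * Real.pi) • η‖ ^ 2 : ℝ) : ℂ)) * 𝓕 (φ i) η := by
      have := map_sub (SchwartzMap.fourierTransformCLM ℂ) ((((k i : ℕ) : ℂ) - z) • φ i)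
        (∑ j, partialD j (partialD j (φ i)))
      rw [map_smul] at this
      have e : 𝓕 (φ' (i, none)) η = ((((k i : ℕ) : ℂ) - z) • 𝓕 (φ i)
        - 𝓕 (∑ j, partialD j (partialD j (φ i)))) η := congrArg (fun f => f η) this
      rw [e, sub_apply, smul_apply, fourier_laplacian, smul_eq_mul]
      ring
    have e1 : ∀ j, 𝓕 (φ' (i, some j)) η
        = (2 * Complex.I) * (((2 * Real.pi) • η) j : ℝ) * 𝓕 (φ i) η := fun j => by
      have := map_smul (SchwartzMap.fourierTransformCLM ℂ) (2 * (1 : ℝ) : ℂ) (partialD j (φ i))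
      have e : 𝓕 (φ' (i, some j)) η = ((2 * (1 : ℝ) : ℂ) • 𝓕 (partialD j (φ i))) η :=
        congrArg (fun f => f η) this
      rw [e, smul_apply, fourier_partialD, PiLp.smul_apply]
      push_cast [smul_eq_mul]
      ring
    rw [Fintype.sum_option, e0, map_smul, fibreOp_apply, mem_levelSpace.1 (hh i), contractOp_apply]
    simp only [e1]
    change _ • h i + ∑ j, _ • annihilate j (h i) = _
    rw [smul_add, Finset.smul_sum, Finset.smul_sum]
    have e2 : ∀ j, (2 * Complex.I * ((((2 * Real.pi) • η) j : ℝ) : ℂ) * 𝓕 (φ i) η)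
          • annihilate j (h i) = 𝓕 (φ i) η • (2 * Complex.I)
          • ((((2 * Real.pi) • η) j : ℝ) : ℂ) • annihilate j (h i) := fun j => by module
    rw [Finset.sum_congr rfl fun j _ => e2 j]
    module
  have hw : ∀ η, (∑ i, 𝓕 (φ i) η • h i) ∈ ⨆ k, levelSpace (n := n) annihilate create k :=
    fun η => Submodule.sum_mem _ fun i _ =>
      Submodule.smul_mem _ _ (Submodule.mem_iSup_of_mem _ (hh i))
  have hL := norm_sum_shearTensorL_sq (n := n) 1 φ h
  have hR := norm_sum_shearTensorL_sq (n := n) 1 φ' h'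
  rw [hP, hL.2, hR.2, ← integral_const_mul]
  refine integral_mono hL.1 (hR.1.const_mul C) fun η => ?_
  simp only [hfib]
  exact hb _ _ (hw η)

end Core

/-! ### Density of the core -/

section Completeness

variable {n : ℕ}

/-- An integrable function with vanishing Fourier transform vanishes almost everywhere. -/
theorem ae_eq_zero_of_fourier_eq_zero {F : EuclideanSpace ℝ (Fin n) → ℂ} (hF : Integrable F)
    (h0 : ∀ ξ, 𝓕 F ξ = 0) : F =ᵐ[volume] 0 := by
  refine ae_eq_zero_of_integral_contDiff_smul_eq_zero hF.locallyIntegrable fun g hg hgc => ?_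
  have h1 : HasCompactSupport (Complex.ofRealCLM ∘ g) := hgc.comp_left rfl
  have h2 : ContDiff ℝ ∞ (Complex.ofRealCLM ∘ g) := by fun_prop
  set ψ : 𝓢(EuclideanSpace ℝ (Fin n), ℂ) := h1.toSchwartzMap h2
  -- The test function is written as a Fourier transform, which is then moved onto `F`.
  have h3 : ∫ x, 𝓕 (𝓕⁻ ψ) x • F x = ∫ x, (𝓕⁻ ψ) x • 𝓕 F x := by
    have := VectorFourier.integral_fourierIntegral_smul_eq_flip
      (L := innerₗ (EuclideanSpace ℝ (Fin n))) Real.continuous_fourierChar continuous_inner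
      (SchwartzMap.integrable (μ := volume) (𝓕⁻ ψ)) hF
    rw [flip_innerₗ] at this
    exact this
  simp only [h0, smul_zero, integral_zero, FourierTransform.fourier_fourierInv_eq] at h3
  rw [← h3]
  rfl

theorem memLp_exp_mul_gaussian {E : Type*} [NormedAddCommGroup E] [InnerProductSpace ℝ E]
    [FiniteDimensional ℝ E] [MeasurableSpace E] [BorelSpace E] (c : ℝ) :
    MemLp (fun v : E => Real.exp (c * ‖v‖) * Real.exp (-(‖v‖ ^ 2 / 4))) 2 := by
  have hcont : Continuous fun v : E => Real.exp (c * ‖v‖) * Real.exp (-(‖v‖ ^ 2 / 4)) := by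
    fun_prop
  rw [memLp_two_iff_integrable_sq hcont.aestronglyMeasurable]
  -- The constant comes from `2cr - r²/2 ≤ 4c² - r²/4`, that is, `(r - 4c)² ≥ 0`.
  have hG : Integrable (fun v : E => Real.exp (4 * c ^ 2) * realGaussian E v) :=
    (SchwartzMap.integrable (realGaussian E)).const_mul _
  refine hG.mono' (hcont.pow 2).aestronglyMeasurable (Filter.Eventually.of_forall fun v => ?_)
  rw [Real.norm_of_nonneg (sq_nonneg _), ← Real.exp_add, ← Real.exp_nat_mul]
  change _ ≤ Real.exp (4 * c ^ 2) * Real.exp (-(‖v‖ ^ 2 / 4))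
  rw [← Real.exp_add, Real.exp_le_exp]
  push_cast
  nlinarith [sq_nonneg (‖v‖ - 4 * c)]

/-- The monomials `v_{j₁} ⋯ v_{j_k} exp (-|v|² / 4)`. -/
def monomialGaussian : List (Fin n) → 𝓢(EuclideanSpace ℝ (Fin n), ℂ)
  | [] => gaussian _
  | j :: l => mulCoord j (monomialGaussian l)

theorem monomialGaussian_mem (l : List (Fin n)) :
    monomialGaussian l ∈ ⨆ k, levelSpace (n := n) annihilate create k := by
  induction l with
  | nil => exact Submodule.mem_iSup_of_mem 0 gaussian_mem_levelSpace
  | cons j l ih => exact mulCoord_mem_iSup_levelSpace ih j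

theorem mulCoord_mem_span_monomialGaussian {f : 𝓢(EuclideanSpace ℝ (Fin n), ℂ)}
    (hf : f ∈ Submodule.span ℂ (Set.range (monomialGaussian (n := n)))) (j : Fin n) :
    mulCoord j f ∈ Submodule.span ℂ (Set.range (monomialGaussian (n := n))) := by
  induction hf using Submodule.span_induction with
  | mem f hf =>
    obtain ⟨l, rfl⟩ := hf
    exact Submodule.subset_span ⟨j :: l, rfl⟩
  | zero => rw [map_zero]; exact Submodule.zero_mem _
  | add f g _ _ hf hg => rw [map_add]; exact Submodule.add_mem _ hf hg
  | smul c f _ hf => rw [map_smul]; exact Submodule.smul_mem _ _ hf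

/-- The functions `⟨v, ξ⟩^k exp (-|v|² / 4)` are combinations of monomials. -/
theorem exists_inner_pow_mul_gaussian (ξ : EuclideanSpace ℝ (Fin n)) (k : ℕ) :
    ∃ f ∈ Submodule.span ℂ (Set.range (monomialGaussian (n := n))),
      ∀ v, f v = ((⟪v, ξ⟫_ℝ : ℝ) : ℂ) ^ k * gaussian (EuclideanSpace ℝ (Fin n)) v := by
  induction k with
  | zero => exact ⟨gaussian _, Submodule.subset_span ⟨[], rfl⟩, fun v => by simp⟩
  | succ k ih =>
    obtain ⟨f, hf, hfv⟩ := ih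
    refine ⟨∑ j, ((ξ j : ℝ) : ℂ) • mulCoord j f, Submodule.sum_mem _ fun j _ =>
      Submodule.smul_mem _ _ (mulCoord_mem_span_monomialGaussian hf j), fun v => ?_⟩
    rw [sum_apply, pow_succ', mul_assoc, ← hfv, PiLp.inner_apply, Complex.ofReal_sum,
      Finset.sum_mul]
    refine Finset.sum_congr rfl fun j _ => ?_
    rw [smul_apply, mulCoord_apply]
    simp
    ring

/-- Completeness of the Hermite functions: a square-integrable function orthogonal to all
monomials times the Gaussian vanishes. -/
theorem ae_eq_zero_of_forall_monomialGaussian {f : EuclideanSpace ℝ (Fin n) → ℂ} (hf : MemLp f 2)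
    (h : ∀ l, ∫ v, monomialGaussian l v * f v = 0) : f =ᵐ[volume] 0 := by
  have hspan : ∀ g ∈ Submodule.span ℂ (Set.range (monomialGaussian (n := n))),
      ∫ v, g v * f v = 0 := by
    intro g hg
    have hint : ∀ g : 𝓢(EuclideanSpace ℝ (Fin n), ℂ), Integrable (fun v => g v * f v) :=
      fun g => (g.memLp 2 volume).integrable_mul hf
    induction hg using Submodule.span_induction with
    | mem g hg =>
      obtain ⟨l, rfl⟩ := hg
      exact h l
    | zero => simp
    | add g g' _ _ hg hg' =>
      simp only [add_apply, add_mul]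
      rw [integral_add (hint g) (hint g'), hg, hg', add_zero]
    | smul c g _ hg =>
      simp only [smul_apply, smul_eq_mul, mul_assoc]
      rw [integral_const_mul, hg, mul_zero]
  set F : EuclideanSpace ℝ (Fin n) → ℂ := fun v => gaussian _ v * f v with hFdef
  -- Finite exponential moments of `F` allow the power series of `e^{-2πi⟨v, ξ⟩}` to be integrated
  -- term by term; each term is a combination of vanishing monomial integrals.
  have hexp : ∀ c : ℝ, Integrable (fun v => Real.exp (c * ‖v‖) * ‖F v‖) := fun c => by
    have := (memLp_exp_mul_gaussian (E := EuclideanSpace ℝ (Fin n)) c).integrable_mul hf.norm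
    refine this.congr (Filter.Eventually.of_forall fun v => ?_)
    simp only [hFdef, Pi.mul_apply, norm_mul, gaussian_apply, Complex.norm_real,
      Real.norm_of_nonneg (Real.exp_pos _).le]
    ring
  have hF : Integrable F := ((gaussian (EuclideanSpace ℝ (Fin n))).memLp 2 volume).integrable_mul hf
  have hFz : ∀ ξ, 𝓕 F ξ = 0 := by
    intro ξ
    rw [Real.fourier_eq']
    set t : EuclideanSpace ℝ (Fin n) → ℂ := fun v =>
      ((-2 * Real.pi * ⟪v, ξ⟫_ℝ : ℝ) : ℂ) * Complex.I with ht
    have htn : ∀ v, ‖t v‖ ≤ (2 * Real.pi * ‖ξ‖) * ‖v‖ := fun v => by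
      simp only [ht, norm_mul, Complex.norm_I, mul_one, Complex.norm_real, norm_neg, Real.norm_ofNat,
        Real.norm_of_nonneg Real.pi_pos.le]
      have := norm_inner_le_norm (𝕜 := ℝ) v ξ
      nlinarith [Real.pi_pos]
    have htc : Continuous t := by fun_prop
    have hsum := hasSum_integral_of_dominated_convergence (μ := volume)
      (F := fun (k : ℕ) v => (t v ^ k / (k.factorial : ℂ)) * F v)
      (f := fun v => Complex.exp (t v) * F v)
      (fun k v => ((2 * Real.pi * ‖ξ‖) * ‖v‖) ^ k / k.factorial * ‖F v‖)
      (fun k => ((htc.pow k).div_const _).aestronglyMeasurable.mul hF.1)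
      (fun k => Filter.Eventually.of_forall fun v => by
        rw [norm_mul, norm_div, norm_pow, Complex.norm_natCast]
        have := htn v
        gcongr)
      (Filter.Eventually.of_forall fun v => (Real.summable_pow_div_factorial _).mul_right _)
      (by
        refine (hexp (2 * Real.pi * ‖ξ‖)).congr (Filter.Eventually.of_forall fun v => ?_)
        change _ = ∑' k : ℕ, _
        rw [tsum_mul_right, Real.exp_eq_exp_ℝ, NormedSpace.exp_eq_tsum_div])
      (Filter.Eventually.of_forall fun v => by
        have := (NormedSpace.expSeries_div_hasSum_exp (t v)).mul_right (F v)
        rwa [← Complex.exp_eq_exp_ℂ] at this)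
    have hterm : ∀ k : ℕ, ∫ v, (t v ^ k / (k.factorial : ℂ)) * F v = 0 := fun k => by
      obtain ⟨g, hg, hgv⟩ := exists_inner_pow_mul_gaussian ξ k
      have e : ∀ v, (t v ^ k / (k.factorial : ℂ)) * F v
          = ((-2 * Real.pi * Complex.I) ^ k / (k.factorial : ℂ)) * (g v * f v) := fun v => by
        rw [hgv]
        simp only [ht, hFdef]
        push_cast
        ring
      simp only [e]
      rw [integral_const_mul, hspan g hg, mul_zero]
    simp only [hterm] at hsum
    exact hsum.unique hasSum_zero
  filter_upwards [ae_eq_zero_of_fourier_eq_zero hF hFz] with v hv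
  have hne : gaussian (EuclideanSpace ℝ (Fin n)) v ≠ 0 := by
    rw [gaussian_apply]
    exact_mod_cast (Real.exp_pos _).ne'
  exact (mul_eq_zero.1 hv).resolve_left hne

end Completeness

/-! ### Density of the core in `L²` of the phase space. -/

section Density

variable {n : ℕ}

theorem shearTensorL_mem_coreSpace_of_mem_iSup (σ : ℝ) (φ : 𝓢(EuclideanSpace ℝ (Fin n), ℂ))
    {h : 𝓢(EuclideanSpace ℝ (Fin n), ℂ)}
    (hh : h ∈ ⨆ k, levelSpace (n := n) annihilate create k) :
    shearTensorL σ φ h ∈ coreSpace n σ := by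
  induction hh using Submodule.iSup_induction' with
  | mem k h hh => exact shearTensorL_mem_coreSpace σ φ hh
  | zero => rw [map_zero]; exact Submodule.zero_mem _
  | add f g _ _ hf hg => rw [map_add]; exact Submodule.add_mem _ hf hg

/-- The measure-preserving shear `(y, v) ↦ (y + σ v, v)`. -/
theorem measurePreserving_shear (σ : ℝ) :
    MeasurePreserving (fun p : Phase n => (p.1 + σ • p.2, p.2)) volume volume := by
  have h1 : MeasurePreserving (fun p : Phase n => (p.1, p.2 + σ • p.1))
      ((volume : Measure (EuclideanSpace ℝ (Fin n))).prod volume)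
      ((volume : Measure (EuclideanSpace ℝ (Fin n))).prod volume) :=
    (MeasurePreserving.id _).skew_product (g := fun v y => y + σ • v)
      (by fun_prop) (Filter.Eventually.of_forall fun v => map_add_right_eq_self _ _)
  have hs : MeasurePreserving (Prod.swap : Phase n → Phase n)
      ((volume : Measure (EuclideanSpace ℝ (Fin n))).prod volume)
      ((volume : Measure (EuclideanSpace ℝ (Fin n))).prod volume) := Measure.measurePreserving_swap
  exact hs.comp (h1.comp hs)

/-- A square-integrable function which annihilates the core vanishes. -/
theorem ae_eq_zero_of_forall_coreSpace (σ : ℝ) {w : Phase n → ℂ} (hw : MemLp w 2)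
    (h : ∀ u ∈ coreSpace n σ, ∫ p, u p * w p = 0) : w =ᵐ[volume] 0 := by
  have hS := measurePreserving_shear (n := n) σ
  -- In unsheared coordinates the core consists of sums of products `φ(y) h(v)`.
  set W : Phase n → ℂ := fun p => w (p.1 + σ • p.2, p.2) with hWdef
  have hW : MemLp W 2 := hw.comp_measurePreserving hS
  have hWprod : MemLp W 2 ((volume : Measure (EuclideanSpace ℝ (Fin n))).prod volume) := hW
  have htensor : ∀ φ g : 𝓢(EuclideanSpace ℝ (Fin n), ℂ),
      Integrable (fun p : Phase n => φ p.1 * g p.2 * W p)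
        ((volume : Measure (EuclideanSpace ℝ (Fin n))).prod volume) := fun φ g => by
    have := ((shearTensorL 0 φ g).memLp 2 (volume : Measure (Phase n))).integrable_mul hW
    refine this.congr (Filter.Eventually.of_forall fun p => ?_)
    simp [shearTensorL_apply]
  have hzero : ∀ φ : 𝓢(EuclideanSpace ℝ (Fin n), ℂ), ∀ l,
      ∫ y, φ y * ∫ v, monomialGaussian l v * W (y, v) = 0 := fun φ l => by
    have h1 := h _ (shearTensorL_mem_coreSpace_of_mem_iSup σ φ (monomialGaussian_mem l))
    have h2 : AEStronglyMeasurable (fun p => shearTensorL σ φ (monomialGaussian l) p * w p)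
        (Measure.map (fun p : Phase n => (p.1 + σ • p.2, p.2)) volume) := by
      rw [hS.map_eq]
      exact (SchwartzMap.continuous _).aestronglyMeasurable.mul hw.1
    rw [← hS.map_eq, integral_map hS.measurable.aemeasurable h2, Measure.volume_eq_prod] at h1
    have e : ∀ p : Phase n, shearTensorL σ φ (monomialGaussian l) (p.1 + σ • p.2, p.2)
        * w (p.1 + σ • p.2, p.2) = φ p.1 * monomialGaussian l p.2 * W p := fun p => by
      simp [shearTensorL_apply, hWdef]
    simp only [e] at h1
    rw [integral_prod _ (htensor φ _)] at h1
    rw [← h1]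
    congr 1
    ext y
    rw [← integral_const_mul]
    simp only [mul_assoc]
  -- The nonvanishing Gaussian factor makes the slice integral integrable in `y`. There are
  -- countably many lists `l`, so the null sets can later be united.
  have hfib : ∀ l, ∀ᵐ y, ∫ v, monomialGaussian l v * W (y, v) = 0 := fun l => by
    set H : EuclideanSpace ℝ (Fin n) → ℂ := fun y =>
      gaussian _ y * ∫ v, monomialGaussian l v * W (y, v) with hH
    have hHint : Integrable H := by
      refine (htensor (gaussian _) (monomialGaussian l)).integral_prod_left.congr
        (Filter.Eventually.of_forall fun y => ?_)
      simp only [hH, mul_assoc]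
      rw [integral_const_mul]
    have hH0 : ∀ᵐ y, H y = 0 := by
      refine ae_eq_zero_of_integral_contDiff_smul_eq_zero hHint.locallyIntegrable
        fun g hg hgc => ?_
      have h1 : HasCompactSupport (Complex.ofRealCLM ∘ g) := hgc.comp_left rfl
      have h2 : ContDiff ℝ ∞ (Complex.ofRealCLM ∘ g) := by fun_prop
      have := hzero (SchwartzMap.pairing (ContinuousLinearMap.mul ℂ ℂ) (h1.toSchwartzMap h2)
        (gaussian _)) l
      rw [← this]
      congr 1
      ext y
      simp [hH, mul_assoc]
    filter_upwards [hH0] with y hy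
    have hne : gaussian (EuclideanSpace ℝ (Fin n)) y ≠ 0 := by
      rw [gaussian_apply]
      exact_mod_cast (Real.exp_pos _).ne'
    exact (mul_eq_zero.1 hy).resolve_left hne
  have hLp : ∀ᵐ y, MemLp (fun v => W (y, v)) 2 := by
    have h2 := ((memLp_two_iff_integrable_sq_norm hWprod.1).1 hWprod).prod_right_ae
    filter_upwards [h2, hWprod.1.prodMk_left] with y hy hy'
    exact (memLp_two_iff_integrable_sq_norm hy').2 hy
  have hW0 : W =ᵐ[(volume : Measure (EuclideanSpace ℝ (Fin n))).prod volume] 0 := by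
    have hy0 : ∀ᵐ y, ∀ᵐ v, W (y, v) = 0 := by
      filter_upwards [hLp, ae_all_iff.2 hfib] with y hy hl
      exact ae_eq_zero_of_forall_monomialGaussian hy hl
    have h2 := (memLp_two_iff_integrable_sq_norm hWprod.1).1 hWprod
    have h3 : ∫ p, ‖W p‖ ^ 2 ∂((volume : Measure (EuclideanSpace ℝ (Fin n))).prod volume) = 0 := by
      rw [integral_prod _ h2]
      refine integral_eq_zero_of_ae ?_
      filter_upwards [hy0] with y hy
      refine integral_eq_zero_of_ae ?_
      filter_upwards [hy] with v hv
      simp [hv]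
    rw [integral_eq_zero_iff_of_nonneg (fun _ => sq_nonneg _) h2] at h3
    filter_upwards [h3] with p hp
    simpa using hp
  have hnorm := eLpNorm_comp_measurePreserving (p := 2) hw.1 hS
  have hz : eLpNorm (w ∘ fun p : Phase n => (p.1 + σ • p.2, p.2)) 2 volume = 0 := by
    rw [eLpNorm_eq_zero_iff (hw.1.comp_measurePreserving hS) (by norm_num)]
    exact hW0
  rw [hz] at hnorm
  exact (eLpNorm_eq_zero_iff hw.1 (by norm_num)).1 hnorm.symm

/-- The core is dense in `L²`. -/
theorem dense_coreSpace (σ : ℝ) :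
    Dense (((coreSpace n σ).map (phaseL2 n) : Submodule ℂ (L2 n)) : Set (L2 n)) := by
  rw [Submodule.dense_iff_topologicalClosure_eq_top, Submodule.topologicalClosure_eq_top_iff,
    Submodule.eq_bot_iff]
  intro w hw
  rw [Submodule.mem_orthogonal'] at hw
  -- Conjugating `w` turns the inner product into the bilinear pairing.
  have h0 := ae_eq_zero_of_forall_coreSpace (n := n) σ (w := fun p => (starRingEnd ℂ) (w p))
    (Lp.memLp w).star fun u hu => by
      have := hw (phaseL2 n u) ⟨u, hu, rfl⟩
      rw [MeasureTheory.L2.inner_def] at this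
      rw [← this]
      refine integral_congr_ae ?_
      filter_upwards [u.coeFn_toLp 2 volume] with p hp
      change u p * _ = inner ℂ (w p) ((u.toLp 2 volume : L2 n) p)
      rw [hp]
      simp
  rw [Lp.eq_zero_iff_ae_eq_zero]
  filter_upwards [h0] with p hp
  simpa using hp

end Density

/-! ### The resolvent off the half-line -/

section Graph

variable {n : ℕ}

theorem mem_freeKFPGraph_iff {u f : L2 n} : (u, f) ∈ freeKFPGraph n ↔
    ∀ φ, L2.toDistrib n u (kfpSchwartz n (-1) φ) = L2.toDistrib n f φ := by
  change freeKFPDistrib n (L2.toDistrib n u) = L2.toDistrib n f ↔ _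
  rw [DFunLike.ext_iff]
  simp only [freeKFPDistrib_apply]

theorem continuous_toDistrib_apply (φ : 𝓢(Phase n, ℂ)) :
    Continuous fun u : L2 n => L2.toDistrib n u φ :=
  (PointwiseConvergenceCLM.evalCLM (RingHom.id ℂ) ℂ φ).continuous.comp
    (Lp.toTemperedDistributionCLM ℂ (volume : Measure (Phase n)) 2).continuous

/-- Each test function imposes one closed condition on the pair. -/
theorem isClosed_freeKFPGraph : IsClosed (freeKFPGraph n : Set (L2 n × L2 n)) := by
  have : (freeKFPGraph n : Set (L2 n × L2 n)) = ⋂ φ : 𝓢(Phase n, ℂ),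
      {p | L2.toDistrib n p.1 (kfpSchwartz n (-1) φ) = L2.toDistrib n p.2 φ} := by
    ext ⟨u, f⟩
    simpa using mem_freeKFPGraph_iff
  rw [this]
  exact isClosed_iInter fun φ => isClosed_eq
    ((continuous_toDistrib_apply _).comp continuous_fst)
    ((continuous_toDistrib_apply _).comp continuous_snd)

theorem phaseL2_mem_freeKFPGraph (f : 𝓢(Phase n, ℂ)) :
    (phaseL2 n f, phaseL2 n (kfpSchwartz n 1 f)) ∈ freeKFPGraph n :=
  freeKFPDistrib_phaseL2 f

theorem graph_freeKFP : (freeKFP n).graph = freeKFPGraph n :=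
  Submodule.toLinearPMap_graph_eq _ (freeKFPGraph_snd_eq_zero n)

theorem freeKFP_eq_of_mem_graph {u f : L2 n} (h : (u, f) ∈ freeKFPGraph n) :
    ∃ hu : u ∈ (freeKFP n).domain, freeKFP n ⟨u, hu⟩ = f := by
  rw [← graph_freeKFP, LinearPMap.mem_graph_iff] at h
  obtain ⟨y, rfl, rfl⟩ := h
  exact ⟨y.2, rfl⟩

/-- By duality: `u` annihilates the image of the transpose minus `z`, which contains the core for `σ
= -1`. The pairing is bilinear, so `z` is not conjugated. -/
theorem eigenvector_eq_zero {z : ℂ} (hz : ¬ (0 ≤ z.re ∧ z.im = 0)) {u : L2 n}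
    (hu : (u, z • u) ∈ freeKFPGraph n) : u = 0 := by
  rw [Lp.eq_zero_iff_ae_eq_zero]
  refine ae_eq_zero_of_forall_coreSpace (n := n) (-1) (Lp.memLp u) fun f hf => ?_
  obtain ⟨g, -, rfl⟩ := exists_preimage_of_mem_coreSpace (σ := -1) (by norm_num) hz hf
  have h1 := mem_freeKFPGraph_iff.1 hu g
  rw [← toDistrib_apply, map_sub, map_smul, h1, map_smul]
  simp

/-- Approximate `f` by core functions and solve there; the resolvent estimate makes the solutions
Cauchy, and closedness of the graph passes to the limit. -/
theorem exists_resolvent_solution {z : ℂ} (hz : ¬ (0 ≤ z.re ∧ z.im = 0)) :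
    ∃ C > 0, ∀ f : L2 n, ∃ u : L2 n, (u, f + z • u) ∈ freeKFPGraph n ∧ ‖u‖ ≤ C * ‖f‖ := by
  obtain ⟨C, hC, hb⟩ := norm_le_of_mem_coreSpace (n := n) hz
  have hb' : ∀ u ∈ coreSpace n 1, ‖phaseL2 n u‖
      ≤ √C * ‖phaseL2 n (kfpSchwartz n 1 u - z • u)‖ := fun u hu => by
    have := Real.sqrt_le_sqrt (hb u hu)
    rwa [Real.sqrt_mul hC.le, Real.sqrt_sq (norm_nonneg _), Real.sqrt_sq (norm_nonneg _)] at this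
  refine ⟨√C, Real.sqrt_pos.2 hC, fun f => ?_⟩
  obtain ⟨F, hF, hFf⟩ := mem_closure_iff_seq_limit.1 (dense_coreSpace (n := n) 1 f)
  choose g hg hgF using hF
  choose u hu hug using fun k => exists_preimage_of_mem_coreSpace (one_pow 2) hz (hg k)
  have huF : ∀ k, phaseL2 n (kfpSchwartz n 1 (u k) - z • u k) = F k := fun k => by
    rw [hug, hgF]
  have hdist : ∀ k l, dist (phaseL2 n (u k)) (phaseL2 n (u l)) ≤ √C * dist (F k) (F l) :=
    fun k l => by
      rw [dist_eq_norm, dist_eq_norm, ← map_sub, ← huF, ← huF, ← map_sub]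
      refine (hb' _ (Submodule.sub_mem _ (hu k) (hu l))).trans_eq ?_
      rw [map_sub (kfpSchwartz n 1), smul_sub]
      congr 3
      abel
  have hcauchy : CauchySeq fun k => phaseL2 n (u k) := by
    rw [Metric.cauchySeq_iff]
    intro ε hε
    obtain ⟨N, hN⟩ := Metric.cauchySeq_iff.1 hFf.cauchySeq (ε / √C)
      (div_pos hε (Real.sqrt_pos.2 hC))
    refine ⟨N, fun k hk l hl => (hdist k l).trans_lt ?_⟩
    have := hN k hk l hl
    rwa [lt_div_iff₀ (Real.sqrt_pos.2 hC), mul_comm] at this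
  obtain ⟨v, hv⟩ := cauchySeq_tendsto_of_complete hcauchy
  refine ⟨v, ?_, ?_⟩
  · refine isClosed_freeKFPGraph.mem_of_tendsto (hv.prodMk_nhds (hFf.add (hv.const_smul z)))
      (Filter.Eventually.of_forall fun k => ?_)
    have := phaseL2_mem_freeKFPGraph (u k)
    rwa [← sub_add_cancel (kfpSchwartz n 1 (u k)) (z • u k), map_add, huF, map_smul] at this
  · exact le_of_tendsto_of_tendsto' hv.norm (hFf.norm.const_mul _) fun k => by
      rw [← huF]
      exact hb' _ (hu k)

theorem mem_resolventSetOf {z : ℂ} (hz : ¬ (0 ≤ z.re ∧ z.im = 0)) :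
    z ∈ resolventSetOf (freeKFP n) := by
  obtain ⟨C, hC, hsol⟩ := exists_resolvent_solution (n := n) hz
  choose r hr hrb using hsol
  have huniq : ∀ {f u : L2 n}, (u, f + z • u) ∈ freeKFPGraph n → r f = u := fun {f u} h => by
    have := (freeKFPGraph n).sub_mem (hr f) h
    rw [Prod.mk_sub_mk, add_sub_add_left_eq_sub, ← smul_sub] at this
    exact sub_eq_zero.1 (eigenvector_eq_zero hz this)
  let R : L2 n →L[ℂ] L2 n := LinearMap.mkContinuous
    { toFun := r
      map_add' := fun f g => huniq <| by
        have := (freeKFPGraph n).add_mem (hr f) (hr g)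
        rw [Prod.mk_add_mk] at this
        convert this using 2
        module
      map_smul' := fun c f => huniq <| by
        have := (freeKFPGraph n).smul_mem c (hr f)
        rwa [Prod.smul_mk, smul_add, smul_comm c z] at this } C hrb
  refine ⟨R, fun f => ?_, fun u => ?_⟩
  · obtain ⟨hu, he⟩ := freeKFP_eq_of_mem_graph (hr f)
    exact ⟨hu, by
      change freeKFP n ⟨r f, hu⟩ - z • r f = f
      rw [he, add_sub_cancel_right]⟩
  · refine huniq ?_
    rw [sub_add_cancel, ← graph_freeKFP]
    exact (freeKFP n).mem_graph u

end Graph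

/-! ### The half-line belongs to the spectrum -/

section HalfLine

variable {n : ℕ}

theorem norm_shearTensorL (σ : ℝ) (φ h : 𝓢(EuclideanSpace ℝ (Fin n), ℂ)) :
    ‖phaseL2 n (shearTensorL σ φ h)‖ = ‖schwartzL2 n φ‖ * ‖schwartzL2 n h‖ := by
  have := inner_shearTensorL σ φ h φ h
  simp only [inner_self_eq_ofReal] at this
  rw [← sq_eq_sq₀ (norm_nonneg _) (by positivity), mul_pow]
  exact_mod_cast this

/-- Approximate eigenfunctions of the Laplacian at every point of `[0, ∞)`. -/
theorem exists_approx_helmholtz (hn : 1 ≤ n) {l : ℝ} (hl : 0 ≤ l) {ε : ℝ} (hε : 0 < ε) :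
    ∃ ψ : 𝓢(EuclideanSpace ℝ (Fin n), ℂ), schwartzL2 n ψ ≠ 0 ∧
      ‖schwartzL2 n (-(l : ℂ) • ψ - ∑ j, partialD j (partialD j ψ))‖ ≤ ε * ‖schwartzL2 n ψ‖ := by
  -- A frequency with `|2πη₀|² = l`; its existence for `l > 0` needs dimension at least one.
  set η₀ : EuclideanSpace ℝ (Fin n) :=
    EuclideanSpace.single ⟨0, hn⟩ (√l / (2 * Real.pi)) with hη₀
  have hval : ‖(2 * Real.pi) • η₀‖ ^ 2 = l := by
    rw [norm_smul, hη₀, PiLp.norm_single, mul_pow, Real.norm_eq_abs, Real.norm_eq_abs,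
      sq_abs, sq_abs, div_pow, Real.sq_sqrt hl]
    have := Real.pi_pos
    field_simp
  have hcont : Continuous fun η : EuclideanSpace ℝ (Fin n) => ‖(2 * Real.pi) • η‖ ^ 2 := by
    fun_prop
  obtain ⟨r, hr, hball⟩ := Metric.continuous_iff.1 hcont η₀ ε hε
  -- Supported where the symbol of `-Δ` differs from `l` by at most `ε`.
  let b : ContDiffBump η₀ := ⟨r / 2, r, by positivity, by linarith⟩
  have h1 : HasCompactSupport (Complex.ofRealCLM ∘ b) := b.hasCompactSupport.comp_left rfl
  have h2 : ContDiff ℝ ∞ (Complex.ofRealCLM ∘ b) := Complex.ofRealCLM.contDiff.comp b.contDiff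
  set g : 𝓢(EuclideanSpace ℝ (Fin n), ℂ) := h1.toSchwartzMap h2
  have hg : ∀ η, g η = ((b η : ℝ) : ℂ) := fun η => rfl
  have hFg : 𝓕 (𝓕⁻ g) = g := FourierTransform.fourier_fourierInv_eq g
  have hne : 𝓕⁻ g ≠ 0 := fun h0 => by
    have h3 : g η₀ = 0 := by
      rw [← hFg, h0]
      have : 𝓕 (0 : 𝓢(EuclideanSpace ℝ (Fin n), ℂ)) = 0 :=
        map_zero (SchwartzMap.fourierTransformCLM ℂ)
      rw [this]
      rfl
    rw [hg, b.one_of_mem_closedBall (Metric.mem_closedBall_self b.rIn_pos.le)] at h3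
    simp at h3
  refine ⟨𝓕⁻ g, fun h0 => hne (schwartzL2_injective (h0.trans (map_zero _).symm)), ?_⟩
  set χ := -(l : ℂ) • 𝓕⁻ g - ∑ j, partialD j (partialD j (𝓕⁻ g)) with hχ
  have hFχ : ∀ η, 𝓕 χ η = ((‖(2 * Real.pi) • η‖ ^ 2 - l : ℝ) : ℂ) * g η := fun η => by
    have h3 := map_sub (SchwartzMap.fourierTransformCLM ℂ) (-(l : ℂ) • 𝓕⁻ g)
      (∑ j, partialD j (partialD j (𝓕⁻ g)))
    rw [map_smul] at h3
    have h4 : 𝓕 χ η = (-(l : ℂ) • 𝓕 (𝓕⁻ g) - 𝓕 (∑ j, partialD j (partialD j (𝓕⁻ g)))) η :=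
      congrArg (fun f => f η) h3
    rw [h4, sub_apply, smul_apply, fourier_laplacian, hFg, smul_eq_mul]
    push_cast
    ring
  rw [schwartzL2_apply, schwartzL2_apply, ← SchwartzMap.norm_fourier_toL2_eq χ,
    ← SchwartzMap.norm_fourier_toL2_eq (𝓕⁻ g), hFg]
  refine Lp.norm_le_mul_norm_of_ae_le_mul ?_
  filter_upwards [(𝓕 χ).coeFn_toLp 2 volume, g.coeFn_toLp 2 volume] with η e1 e2
  rw [e1, e2, hFχ, norm_mul, Complex.norm_real]
  by_cases hη : dist η η₀ < r
  · have h5 := hball η hη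
    rw [hval, Real.dist_eq] at h5
    gcongr
    exact h5.le
  · have h6 : g η = 0 := by
      rw [hg, b.zero_of_le_dist (not_lt.1 hη)]
      rfl
    rw [h6, norm_zero, mul_zero, mul_zero]

theorem notMem_resolventSetOf (hn : 1 ≤ n) {z : ℂ} (hz : 0 ≤ z.re ∧ z.im = 0) :
    z ∉ resolventSetOf (freeKFP n) := by
  rintro ⟨R, -, hR⟩
  -- The tolerance `(‖R‖ + 1)⁻¹` makes `‖R‖ ε < 1`, also when `R = 0`. Only the left-inverse
  -- property of `R` is contradicted.
  obtain ⟨ψ, hψ0, hψ⟩ := exists_approx_helmholtz hn hz.1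
    (inv_pos.2 (by positivity : 0 < ‖R‖ + 1))
  have hzr : z = (z.re : ℂ) := Complex.ext rfl (by simp [hz.2])
  set G := gaussian (EuclideanSpace ℝ (Fin n)) with hG
  set u := shearTensorL (1 : ℝ) ψ G
  obtain ⟨hu, he⟩ := freeKFP_eq_of_mem_graph (phaseL2_mem_freeKFPGraph u)
  have h1 := hR ⟨phaseL2 n u, hu⟩
  have h2 : kfpSchwartz n 1 u - z • u
      = shearTensorL 1 (-(z.re : ℂ) • ψ - ∑ j, partialD j (partialD j ψ)) G := by
    rw [kfpSchwartz_sub_shearTensorL (one_pow 2) z ψ gaussian_mem_levelSpace]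
    simp only [annihilate_gaussian, map_zero, Finset.sum_const_zero, add_zero, Nat.cast_zero,
      zero_sub, ← hzr, hG]
  rw [he, ← map_smul, ← map_sub, h2] at h1
  have h3 := R.le_opNorm (phaseL2 n
    (shearTensorL 1 (-(z.re : ℂ) • ψ - ∑ j, partialD j (partialD j ψ)) G))
  rw [h1, norm_shearTensorL] at h3
  rw [norm_shearTensorL] at h3
  have hG0 : 0 < ‖schwartzL2 n G‖ := by
    rw [norm_pos_iff]
    intro h0
    have h5 : G = 0 := schwartzL2_injective (h0.trans (map_zero _).symm)
    have h6 : G 0 = 0 := by rw [h5]; rfl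
    rw [hG, gaussian_apply] at h6
    simp at h6
  have hψpos : 0 < ‖schwartzL2 n ψ‖ := norm_pos_iff.2 hψ0
  have h4 : ‖schwartzL2 n ψ‖ * ‖schwartzL2 n G‖
      ≤ (‖R‖ * (‖R‖ + 1)⁻¹) * (‖schwartzL2 n ψ‖ * ‖schwartzL2 n G‖) := by
    refine h3.trans ?_
    calc ‖R‖ * (‖schwartzL2 n (-(z.re : ℂ) • ψ - ∑ j, partialD j (partialD j ψ))‖
          * ‖schwartzL2 n G‖)
        ≤ ‖R‖ * (((‖R‖ + 1)⁻¹ * ‖schwartzL2 n ψ‖) * ‖schwartzL2 n G‖) := by gcongr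
      _ = _ := by ring
  have h5 : ‖R‖ * (‖R‖ + 1)⁻¹ < 1 := by
    rw [← div_eq_mul_inv, div_lt_one (by positivity)]
    linarith
  nlinarith [mul_pos hψpos hG0]

end HalfLine

end KFP

end

theorem mainTheorem9 (n : ℕ) (hn : 1 ≤ n) :
    KFP.spectrumOf (KFP.freeKFP n) = {z : ℂ | 0 ≤ z.re ∧ z.im = 0} := by
  ext z
  rw [KFP.spectrumOf, Set.mem_compl_iff]
  refine ⟨fun h => ?_, fun h => KFP.notMem_resolventSetOf hn h⟩
  by_contra hz
  exact h (KFP.mem_resolventSetOf hz)
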